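/- \textbf{Uniform bounds for the matrix Riccati equation.} Let $T>0$, let $A:[0,T]\to\mathbb R^{n_x\times n_x}$, $B:[0,T]\to\mathbb R^{n_x\times n_u}$, $Q:[0,T]\to\mathbb R^{n_x\times n_x}$, $H:[0,T]\to\mathbb R^{n_u\times n_x}$, $R:[0,T]\to\mathbb R^{n_u\times n_u}$ be matrix functions and let $Q_T\in\mathbb R^{n_x\times n_x}$. $\|\cdot\|$ is the operator norm induced by the Euclidean norms, and $M\preceq N$ means that $N-M$ is symmetric positive semidefinite. $\Phi_A(t,s)$ is the evolution operator of $\dot x=Ax$ (i.e. $\partial_t\Phi_A(t,s)=A(t)\Phi_A(t,s)$, $\Phi_A(s,s)=I$), and $$W_{A,B}(t_0,t_1)=\int_{t_0}^{t_1}\Phi_A(t_0,s)B(s)B(s)^\top\Phi_A(t_0,s)^\top\,ds .$$ Assume: \begin{enumerate} \item (Boundedness) $A,B,Q,H,R$ are continuous on $[0,T]$ and $\|A(t)\|\le\lambda_A$, $\|B(t)\|\le\lambda_B$, $\|Q(t)\|\le\lambda_Q$, $\|H(t)\|\le\lambda_H$, $\|R(t)\|\le\lambda_R$ for all $t\in[0,T]$,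 with constants $\lambda_A,\lambda_B,\lambda_Q,\lambda_H,\lambda_R>0$. \item (Uniform complete controllability) There are $\sigma\in(0,T)$ and constants $\alpha_0,\alpha_1,\beta_0,\beta_1>0$ such that for every $t_0\in[0,T-\sigma]$ there is $t_1\in[t_0,t_0+\sigma]$ with $$\alpha_0I\preceq W_{A,B}(t_0,t_1)\preceq\alpha_1I,\qquad \beta_0I\preceq\Phi_A(t_1,t_0)W_{A,B}(t_0,t_1)\Phi_A(t_1,t_0)^\top\preceq\beta_1I .$$ \item (Coercivity) There are $\gamma_R,\gamma_Q>0$ with $\gamma_Q\le\lambda_Q$ such that $R(t)\succeq\gamma_RI$ and $Q(t)-H(t)^\top R(t)^{-1}H(t)\succeq\gamma_QI$ for all $t\in[0,T]$, and $\gamma_QI\preceq Q_T\preceq\lambda_QI$. \end{enumerate} Then the matrix Riccati equation $$\dot S=SBR^{-1}B^\top S-S(A-BR^{-1}H)-(A-BR^{-1}H)^\top S-(Q-H^\top R^{-1}H)\ \text{ on }[0,T),\qquad S(T)=Q_T,$$ has exactly one solution $S:[0,T]\to\mathbb R^{n_x\times n_x}$ (continuous on $[0,T]$, differentiable on $[0,T)$),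 and $$c_0(\sigma)I\preceq S(t)\preceq c_1(\sigma)I\qquad\text{for all }t\in[0,T],$$ where $c_0(\sigma),c_1(\sigma)>0$ are the following constants, which do not depend on $T$. With $\mu=\lambda_A+\lambda_B\lambda_H/\gamma_R$, $$\tilde\alpha_0=\frac{1-e^{-2\mu\sigma}}{2\mu},\quad \tilde\alpha_1=\frac{e^{2\mu\sigma}-1}{2\mu},\quad \alpha_1'=\frac{\lambda_B^2(e^{2\mu\sigma}-1)}{2\mu},$$ $$\alpha_0'=\Big(\frac{2}{\alpha_0}+\frac{(\lambda_H/\gamma_R)^2}{\lambda_A}\Big(1+\frac{\alpha_1}{\alpha_0}\Big)^2(e^{2\lambda_A\sigma}-1)\Big)^{-1},$$ $$c_0(\sigma)=\min\Big\{2\mu\Big(\frac{\lambda_B^2}{\gamma_R}\Big(1+\frac{\tilde\alpha_1}{\tilde\alpha_0}\Big)^2+\frac{1}{\gamma_Q\tilde\alpha_0^2}\Big)^{-1},\ \Big(\frac{\lambda_B^2}{2\gamma_R\mu}+\frac1{\gamma_Q}\Big)^{-1}\Big\}e^{-2\mu\sigma},$$ $$c_1(\sigma)=\max\Big\{\Big(\Big(\lambda_Q+\frac{\lambda_H^2}{\gamma_R}\Big)\Big(1+\frac{\alpha_1'}{\alpha_0'}\Big)^2+\frac{\lambda_R\lambda_B^2}{(\alpha_0')^2}\Big)\frac1{2\mu},\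 \Big(\lambda_Q+\frac{\lambda_H^2}{\gamma_R}\Big)\Big(1+\frac1{2\mu}\Big)\Big\}e^{2\mu\sigma}.$$ -/

import Mathlib

open Set MeasureTheory
open scoped Matrix Matrix.Norms.L2Operator MatrixOrder

/- Throughout, `‖M‖` is the operator norm of a real matrix induced by the Euclidean norms, and
`M ≤ N` is the Loewner order, i.e. `N - M` is symmetric positive semidefinite. -/

/-- The terms of the Peano-Baker series of `ẋ = A x` started at time `s`. -/
noncomputable def peanoBakerTerm {n : ℕ} (A : ℝ → Matrix (Fin n) (Fin n) ℝ) (s : ℝ) :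
    ℕ → ℝ → Matrix (Fin n) (Fin n) ℝ
  | 0 => fun _ => 1
  | k + 1 => fun t => ∫ τ in s..t, A τ * peanoBakerTerm A s k τ

/-- The evolution operator `Φ_A(t, s)` of the homogeneous system `ẋ = A x`, constructed by the
Peano-Baker series. -/
noncomputable def evolutionOperator {n : ℕ} (A : ℝ → Matrix (Fin n) (Fin n) ℝ) (t s : ℝ) :
    Matrix (Fin n) (Fin n) ℝ :=
  ∑' k, peanoBakerTerm A s k t

theorem evolutionOperator_self {n : ℕ} (A : ℝ → Matrix (Fin n) (Fin n) ℝ) (s : ℝ) :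
    evolutionOperator A s s = 1 := by
  unfold evolutionOperator
  rw [tsum_eq_single 0]
  · simp [peanoBakerTerm]
  · intro k hk
    obtain ⟨j, rfl⟩ := Nat.exists_eq_succ_of_ne_zero hk
    simp [peanoBakerTerm]

theorem peanoBakerTerm_continuousOn {n : ℕ} {T : ℝ} {A : ℝ → Matrix (Fin n) (Fin n) ℝ}
    (hA : ContinuousOn A (Icc 0 T)) {s : ℝ} (hs : s ∈ Icc 0 T) (k : ℕ) :
    ContinuousOn (peanoBakerTerm A s k) (Icc 0 T) := by
  induction k with
  | zero => exact continuousOn_const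
  | succ k ih =>
    have hT : (0 : ℝ) ≤ T := hs.1.trans hs.2
    have h := intervalIntegral.continuousOn_primitive_interval' (a := s) (b₁ := 0) (b₂ := T)
      (f := fun τ => A τ * peanoBakerTerm A s k τ) (μ := volume)
      (ContinuousOn.intervalIntegrable (by rw [uIcc_of_le hT]; exact hA.mul ih))
      (by rw [uIcc_of_le hT]; exact hs)
    rw [uIcc_of_le hT] at h
    exact h

theorem peanoBakerTerm_norm_le {n : ℕ} {T K : ℝ} {A : ℝ → Matrix (Fin n) (Fin n) ℝ}
    (hK : ∀ t ∈ Icc 0 T, ‖A t‖ ≤ K) {s : ℝ} (hs : s ∈ Icc 0 T) (k : ℕ) :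
    ∀ t ∈ Icc 0 T, ‖peanoBakerTerm A s k t‖ ≤
      ‖(1 : Matrix (Fin n) (Fin n) ℝ)‖ * ((K * |t - s|) ^ k / (k.factorial : ℝ)) := by
  have hK0 : 0 ≤ K := (norm_nonneg _).trans (hK s hs)
  induction k with
  | zero => intro t _; simp [peanoBakerTerm]
  | succ k ih =>
    intro t ht
    set c := ‖(1 : Matrix (Fin n) (Fin n) ℝ)‖
    have hsub : uIcc s t ⊆ Icc 0 T := uIcc_subset_Icc hs ht
    have h1 : ‖∫ τ in s..t, A τ * peanoBakerTerm A s k τ‖ ≤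
        |∫ τ in s..t, K * (c * ((K * |τ - s|) ^ k / (k.factorial : ℝ)))| := by
      apply intervalIntegral.norm_integral_le_abs_of_norm_le
      · refine ae_restrict_of_forall_mem measurableSet_uIoc fun τ hτ => ?_
        have hτ' := hsub (uIoc_subset_uIcc hτ)
        exact (norm_mul_le _ _).trans
          (mul_le_mul (hK τ hτ') (ih τ hτ') (norm_nonneg _) hK0)
      · apply Continuous.intervalIntegrable
        fun_prop
    refine h1.trans (le_of_eq ?_)
    have h2 : ∀ τ : ℝ, K * (c * ((K * |τ - s|) ^ k / (k.factorial : ℝ))) =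
        (K ^ (k + 1) * c / (k.factorial : ℝ)) * |τ - s| ^ k := by
      intro τ; rw [mul_pow]; ring
    simp_rw [h2]
    rw [intervalIntegral.integral_const_mul, abs_mul]
    have h3 : |∫ τ in s..t, |τ - s| ^ k| = |t - s| ^ (k + 1) / (k + 1) := by
      rw [intervalIntegral.integral_comp_sub_right (fun x => |x| ^ k) s, sub_self]
      rcases le_total 0 (t - s) with h | h
      · have : ∫ x in (0 : ℝ)..(t - s), |x| ^ k = ∫ x in (0 : ℝ)..(t - s), x ^ k := by
          apply intervalIntegral.integral_congr
          intro x hx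
          rw [uIcc_of_le h] at hx
          simp [abs_of_nonneg hx.1]
        rw [this, integral_pow, abs_of_nonneg h]
        simp only [ne_eq, Nat.add_eq_zero_iff, one_ne_zero, and_false, not_false_eq_true,
          zero_pow, sub_zero]
        rw [abs_of_nonneg (by positivity)]
      · have : ∫ x in (0 : ℝ)..(t - s), |x| ^ k = ∫ x in (0 : ℝ)..(t - s), (-x) ^ k := by
          apply intervalIntegral.integral_congr
          intro x hx
          rw [uIcc_of_ge h] at hx
          simp [abs_of_nonpos hx.2]
        rw [this, intervalIntegral.integral_comp_neg (fun x => x ^ k), integral_pow,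
          abs_of_nonpos h]
        have h' : 0 ≤ -(t - s) := by linarith
        simp only [neg_zero, ne_eq, Nat.add_eq_zero_iff, one_ne_zero, and_false,
          not_false_eq_true, zero_pow, zero_sub, abs_neg, abs_div]
        rw [abs_of_nonneg (by positivity), abs_of_nonneg (by positivity)]
    rw [h3, abs_of_nonneg (by positivity), Nat.factorial_succ, mul_pow]
    push_cast
    field_simp

/-- The series indeed solves `∂ₜ Φ_A(t, s) = A(t) Φ_A(t, s)` on `[0, T]`. -/
theorem evolutionOperator_hasDerivWithinAt {n : ℕ} {T : ℝ}
    {A : ℝ → Matrix (Fin n) (Fin n) ℝ} (hA : ContinuousOn A (Icc 0 T))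
    {s t : ℝ} (hs : s ∈ Icc 0 T) (ht : t ∈ Icc 0 T) :
    HasDerivWithinAt (fun r => evolutionOperator A r s) (A t * evolutionOperator A t s)
      (Icc 0 T) t := by
  obtain ⟨K, hK⟩ := isCompact_Icc.exists_bound_of_continuousOn hA
  have hK0 : 0 ≤ K := (norm_nonneg _).trans (hK s hs)
  have hT : (0 : ℝ) ≤ T := hs.1.trans hs.2
  set c := ‖(1 : Matrix (Fin n) (Fin n) ℝ)‖
  let b : ℕ → ℝ := fun k => c * ((K * T) ^ k / (k.factorial : ℝ))
  have hb : Summable b := (Real.summable_pow_div_factorial (K * T)).mul_left c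
  have hle : ∀ k, ∀ r ∈ Icc 0 T, ‖peanoBakerTerm A s k r‖ ≤ b k := by
    intro k r hr
    refine (peanoBakerTerm_norm_le hK hs k r hr).trans ?_
    have : |r - s| ≤ T := by
      rw [abs_le]; constructor <;> linarith [hr.1, hr.2, hs.1, hs.2]
    have hc : 0 ≤ c := norm_nonneg _
    simp only [b]
    gcongr
  have hcont : ContinuousOn (fun r => evolutionOperator A r s) (Icc 0 T) :=
    continuousOn_tsum (fun k => peanoBakerTerm_continuousOn hA hs k) hb hle
  have hsum : ∀ r ∈ Icc 0 T, Summable fun k => peanoBakerTerm A s k r := fun r hr =>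
    Summable.of_norm_bounded hb fun k => hle k r hr
  have hint : ∀ r ∈ Icc 0 T, evolutionOperator A r s =
      1 + ∫ τ in s..r, A τ * evolutionOperator A τ s := by
    intro r hr
    have hsub : uIcc s r ⊆ Icc 0 T := uIcc_subset_Icc hs hr
    have key : HasSum (fun k => ∫ τ in s..r, A τ * peanoBakerTerm A s k τ)
        (∫ τ in s..r, A τ * evolutionOperator A τ s) := by
      apply intervalIntegral.hasSum_integral_of_dominated_convergence
        (bound := fun k _ => K * b k)
      · intro k
        exact ((hA.mul (peanoBakerTerm_continuousOn hA hs k)).mono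
          (uIoc_subset_uIcc.trans hsub)).aestronglyMeasurable measurableSet_uIoc
      · intro k
        refine Filter.Eventually.of_forall fun τ hτ => ?_
        have hτ' := hsub (uIoc_subset_uIcc hτ)
        exact (norm_mul_le _ _).trans
          (mul_le_mul (hK τ hτ') (hle k τ hτ') (norm_nonneg _) hK0)
      · exact Filter.Eventually.of_forall fun τ _ => hb.mul_left K
      · exact intervalIntegrable_const
      · refine Filter.Eventually.of_forall fun τ hτ => ?_
        have hτ' := hsub (uIoc_subset_uIcc hτ)
        exact (hsum τ hτ').hasSum.mul_left (A τ)
    rw [← key.tsum_eq]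
    exact (hsum r hr).tsum_eq_zero_add
  have hf : ContinuousOn (fun τ => A τ * evolutionOperator A τ s) (Icc 0 T) := hA.mul hcont
  have hd : HasDerivWithinAt (fun r => ∫ τ in s..r, A τ * evolutionOperator A τ s)
      (A t * evolutionOperator A t s) (Icc 0 T) t := by
    have : Fact (t ∈ Icc 0 T) := ⟨ht⟩
    apply intervalIntegral.integral_hasDerivWithinAt_right
    · exact (hf.mono (uIcc_subset_Icc hs ht)).intervalIntegrable
    · exact hf.stronglyMeasurableAtFilter_nhdsWithin measurableSet_Icc t
    · exact hf t ht
  exact (hd.const_add 1).congr (fun r hr => hint r hr) (hint t ht)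

/-- The controllability Gramian
`W_{A,B}(t₀, t₁) = ∫_{t₀}^{t₁} Φ_A(t₀, s) B(s) B(s)ᵀ Φ_A(t₀, s)ᵀ ds`. -/
noncomputable def gramian {n m : ℕ} (A : ℝ → Matrix (Fin n) (Fin n) ℝ)
    (B : ℝ → Matrix (Fin n) (Fin m) ℝ) (t₀ t₁ : ℝ) : Matrix (Fin n) (Fin n) ℝ :=
  ∫ s in t₀..t₁, evolutionOperator A t₀ s * B s * (B s)ᵀ * (evolutionOperator A t₀ s)ᵀ

/-- Continuity and uniform boundedness of the problem data on `[0, T]`. -/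
structure BoundedData {n m : ℕ} (T lamA lamB lamQ lamH lamR : ℝ)
    (A : ℝ → Matrix (Fin n) (Fin n) ℝ) (B : ℝ → Matrix (Fin n) (Fin m) ℝ)
    (Q : ℝ → Matrix (Fin n) (Fin n) ℝ) (H : ℝ → Matrix (Fin m) (Fin n) ℝ)
    (R : ℝ → Matrix (Fin m) (Fin m) ℝ) : Prop where
  lamA_pos : 0 < lamA
  lamB_pos : 0 < lamB
  lamQ_pos : 0 < lamQ
  lamH_pos : 0 < lamH
  lamR_pos : 0 < lamR
  continuousOn_A : ContinuousOn A (Icc 0 T)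
  continuousOn_B : ContinuousOn B (Icc 0 T)
  continuousOn_Q : ContinuousOn Q (Icc 0 T)
  continuousOn_H : ContinuousOn H (Icc 0 T)
  continuousOn_R : ContinuousOn R (Icc 0 T)
  norm_A_le : ∀ t ∈ Icc 0 T, ‖A t‖ ≤ lamA
  norm_B_le : ∀ t ∈ Icc 0 T, ‖B t‖ ≤ lamB
  norm_Q_le : ∀ t ∈ Icc 0 T, ‖Q t‖ ≤ lamQ
  norm_H_le : ∀ t ∈ Icc 0 T, ‖H t‖ ≤ lamH
  norm_R_le : ∀ t ∈ Icc 0 T, ‖R t‖ ≤ lamR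

/-- Uniform complete controllability of the pair `(A, B)` on `[0, T]`, with window length `σ`. -/
structure UniformlyCompletelyControllable {n m : ℕ} (T σ α₀ α₁ β₀ β₁ : ℝ)
    (A : ℝ → Matrix (Fin n) (Fin n) ℝ) (B : ℝ → Matrix (Fin n) (Fin m) ℝ) : Prop where
  σ_mem : σ ∈ Ioo 0 T
  α₀_pos : 0 < α₀
  α₁_pos : 0 < α₁
  β₀_pos : 0 < β₀
  β₁_pos : 0 < β₁
  bounds : ∀ t₀ ∈ Icc 0 (T - σ), ∃ t₁ ∈ Icc t₀ (t₀ + σ),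
    α₀ • (1 : Matrix (Fin n) (Fin n) ℝ) ≤ gramian A B t₀ t₁ ∧
    gramian A B t₀ t₁ ≤ α₁ • (1 : Matrix (Fin n) (Fin n) ℝ) ∧
    β₀ • (1 : Matrix (Fin n) (Fin n) ℝ) ≤
      evolutionOperator A t₁ t₀ * gramian A B t₀ t₁ * (evolutionOperator A t₁ t₀)ᵀ ∧
    evolutionOperator A t₁ t₀ * gramian A B t₀ t₁ * (evolutionOperator A t₁ t₀)ᵀ ≤
      β₁ • (1 : Matrix (Fin n) (Fin n) ℝ)

/-- Coercivity of the running and terminal costs. -/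
structure CoerciveCost {n m : ℕ} (T γR γQ lamQ : ℝ)
    (Q : ℝ → Matrix (Fin n) (Fin n) ℝ) (H : ℝ → Matrix (Fin m) (Fin n) ℝ)
    (R : ℝ → Matrix (Fin m) (Fin m) ℝ) (QT : Matrix (Fin n) (Fin n) ℝ) : Prop where
  γR_pos : 0 < γR
  γQ_pos : 0 < γQ
  γQ_le : γQ ≤ lamQ
  le_R : ∀ t ∈ Icc 0 T, γR • (1 : Matrix (Fin m) (Fin m) ℝ) ≤ R t
  le_Q : ∀ t ∈ Icc 0 T,
    γQ • (1 : Matrix (Fin n) (Fin n) ℝ) ≤ Q t - (H t)ᵀ * (R t)⁻¹ * H t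
  le_QT : γQ • (1 : Matrix (Fin n) (Fin n) ℝ) ≤ QT
  QT_le : QT ≤ lamQ • (1 : Matrix (Fin n) (Fin n) ℝ)

/-- `S` solves on `[0, T]` the matrix Riccati equation
`Ṡ = S B R⁻¹ Bᵀ S - S (A - B R⁻¹ H) - (A - B R⁻¹ H)ᵀ S - (Q - Hᵀ R⁻¹ H)`, `S(T) = Q_T`. -/
structure IsRiccatiSolution {n m : ℕ} (T : ℝ)
    (A : ℝ → Matrix (Fin n) (Fin n) ℝ) (B : ℝ → Matrix (Fin n) (Fin m) ℝ)
    (Q : ℝ → Matrix (Fin n) (Fin n) ℝ) (H : ℝ → Matrix (Fin m) (Fin n) ℝ)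
    (R : ℝ → Matrix (Fin m) (Fin m) ℝ) (QT : Matrix (Fin n) (Fin n) ℝ)
    (S : ℝ → Matrix (Fin n) (Fin n) ℝ) : Prop where
  continuousOn : ContinuousOn S (Icc 0 T)
  hasDeriv : ∀ t ∈ Ico 0 T, HasDerivWithinAt S
    (S t * B t * (R t)⁻¹ * (B t)ᵀ * S t
      - S t * (A t - B t * (R t)⁻¹ * H t)
      - (A t - B t * (R t)⁻¹ * H t)ᵀ * S t
      - (Q t - (H t)ᵀ * (R t)⁻¹ * H t)) (Icc 0 T) t
  terminal : S T = QT

/-- `μ = λ_A + λ_B λ_H / γ_R`. -/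
noncomputable def growthRate (lamA lamB lamH γR : ℝ) : ℝ := lamA + lamB * lamH / γR

/-- `α₀'(σ)`, with `λ_F = λ_H / γ_R`. -/
noncomputable def shiftedAlpha₀ (lamA lamH γR α₀ α₁ σ : ℝ) : ℝ :=
  (2 / α₀ + (lamH / γR) ^ 2 / lamA * (1 + α₁ / α₀) ^ 2 * (Real.exp (2 * lamA * σ) - 1))⁻¹

/-- `α₁'(σ)`, with `λ_F = λ_H / γ_R`. -/
noncomputable def shiftedAlpha₁ (lamA lamB lamH γR σ : ℝ) : ℝ :=
  lamB ^ 2 * (Real.exp (2 * σ * growthRate lamA lamB lamH γR) - 1) /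
    (2 * growthRate lamA lamB lamH γR)

/-- `α̃₀(σ)`. -/
noncomputable def dualAlpha₀ (lamA lamB lamH γR σ : ℝ) : ℝ :=
  1 / (2 * growthRate lamA lamB lamH γR) *
    (1 - Real.exp (-2 * growthRate lamA lamB lamH γR * σ))

/-- `α̃₁(σ)`. -/
noncomputable def dualAlpha₁ (lamA lamB lamH γR σ : ℝ) : ℝ :=
  1 / (2 * growthRate lamA lamB lamH γR) *
    (Real.exp (2 * growthRate lamA lamB lamH γR * σ) - 1)

/-- The lower constant `c₀(σ)`. -/
noncomputable def riccatiLower (lamA lamB lamH γR γQ σ : ℝ) : ℝ :=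
  min
    (2 * growthRate lamA lamB lamH γR *
      (lamB ^ 2 / γR *
          (1 + dualAlpha₁ lamA lamB lamH γR σ / dualAlpha₀ lamA lamB lamH γR σ) ^ 2
        + 1 / (γQ * dualAlpha₀ lamA lamB lamH γR σ ^ 2))⁻¹)
    (lamB ^ 2 / (2 * γR * growthRate lamA lamB lamH γR) + 1 / γQ)⁻¹
  * Real.exp (-2 * growthRate lamA lamB lamH γR * σ)

/-- The upper constant `c₁(σ)`. -/
noncomputable def riccatiUpper (lamA lamB lamQ lamH lamR γR α₀ α₁ σ : ℝ) : ℝ :=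
  max
    (((lamQ + lamH ^ 2 / γR) *
          (1 + shiftedAlpha₁ lamA lamB lamH γR σ / shiftedAlpha₀ lamA lamH γR α₀ α₁ σ) ^ 2
        + lamR * lamB ^ 2 / shiftedAlpha₀ lamA lamH γR α₀ α₁ σ ^ 2)
      * (1 / (2 * growthRate lamA lamB lamH γR)))
    ((lamQ + lamH ^ 2 / γR) * (1 + 1 / (2 * growthRate lamA lamB lamH γR)))
  * Real.exp (2 * growthRate lamA lamB lamH γR * σ)

/-! Write `F = A - B R⁻¹ H`, `G = B R⁻¹ Bᵀ`, `P = Q - Hᵀ R⁻¹ H`. The matrix `S t` is the value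
function of a linear-quadratic control problem: along `ẋ = F x + B v`, completing the square gives
`d/dt (x · S x) + x · P x + v · R v ≥ 0`, with equality for the optimal feedback
(`riccati_form_hasDerivWithinAt`, `neg_inputCost_le`). Every admissible control therefore bounds `S
t` from above by its cost.

Existence is linear: the Riccati flow is the quotient `Y X⁻¹` of a Hamiltonian system, and
positivity of `G`, `P` and `QT` keeps `X` invertible (`exists_symmetric_riccati_solution`).
Uniqueness holds because the difference of two solutions, paired along their two closed-loop flows,
is constant and vanishes at `T` (`riccati_solution_unique`).

For the upper bound, when a whole window of length `σ` remains, the state is driven to `0` by the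
minimum energy control of `(A, B)` plus a term cancelling the feedback
(`riccati_le_of_minimum_energy`); closer to `T` the control is zero (`riccati_le_of_free_motion`).
The elapsed time is at most `σ`, so the constants do not see `T`.

For the lower bound, the conjugate form `2 ξ · x - x · S x` is bounded above by the cost of a
control of the adjoint system started at `ξ` (`riccati_dual_estimate`). That system has the identity
as input matrix, so a linear profile steers it to `0` in time `σ`; near `T` it is left free and the
coercivity of `QT` pays for the final state. What remains is to compare the resulting constants with
the stated ones, which are larger above and smaller below. -/

/-! ### Calculus of vector and matrix functions. -/

theorem HasDerivWithinAt.dotProduct {ι : Type*} [Fintype ι] {f g : ℝ → ι → ℝ} {f' g' : ι → ℝ}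
    {s : Set ℝ} {t : ℝ} (hf : HasDerivWithinAt f f' s t) (hg : HasDerivWithinAt g g' s t) :
    HasDerivWithinAt (fun r => f r ⬝ᵥ g r) (f' ⬝ᵥ g t + f t ⬝ᵥ g') s t := by
  have h := HasDerivWithinAt.fun_sum (u := Finset.univ)
    fun i _ => (hasDerivWithinAt_pi.1 hf i).mul (hasDerivWithinAt_pi.1 hg i)
  rw [Finset.sum_add_distrib] at h
  exact h

theorem HasDerivWithinAt.matrix_apply {k l : ℕ} {F : ℝ → Matrix (Fin k) (Fin l) ℝ}
    {F' : Matrix (Fin k) (Fin l) ℝ} {s : Set ℝ} {t : ℝ} (hF : HasDerivWithinAt F F' s t)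
    (i : Fin k) (j : Fin l) : HasDerivWithinAt (fun r => F r i j) (F' i j) s t :=
  (LinearMap.toContinuousLinearMap
    (Matrix.entryLinearMap ℝ ℝ i j)).hasFDerivAt.comp_hasDerivWithinAt t hF

theorem HasDerivWithinAt.matrix_mulVec {k l : ℕ} {F : ℝ → Matrix (Fin k) (Fin l) ℝ}
    {F' : Matrix (Fin k) (Fin l) ℝ} {g : ℝ → Fin l → ℝ} {g' : Fin l → ℝ} {s : Set ℝ} {t : ℝ}
    (hF : HasDerivWithinAt F F' s t) (hg : HasDerivWithinAt g g' s t) :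
    HasDerivWithinAt (fun r => F r *ᵥ g r) (F' *ᵥ g t + F t *ᵥ g') s t := by
  refine hasDerivWithinAt_pi.2 fun i => ?_
  exact (hasDerivWithinAt_pi.2 fun j => hF.matrix_apply i j).dotProduct hg

theorem HasDerivWithinAt.matrix_mulVec_const {k l : ℕ} {F : ℝ → Matrix (Fin k) (Fin l) ℝ}
    {F' : Matrix (Fin k) (Fin l) ℝ} {s : Set ℝ} {t : ℝ}
    (hF : HasDerivWithinAt F F' s t) (x : Fin l → ℝ) :
    HasDerivWithinAt (fun r => F r *ᵥ x) (F' *ᵥ x) s t := by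
  simpa using hF.matrix_mulVec (hasDerivWithinAt_const t s x)

theorem HasDerivWithinAt.matrix_inv {k : ℕ} {F : ℝ → Matrix (Fin k) (Fin k) ℝ}
    {F' : Matrix (Fin k) (Fin k) ℝ} {s : Set ℝ} {t : ℝ}
    (hF : HasDerivWithinAt F F' s t) (hu : IsUnit (F t)) :
    HasDerivWithinAt (fun r => (F r)⁻¹) (-((F t)⁻¹ * F' * (F t)⁻¹)) s t := by
  obtain ⟨u, hu⟩ := hu
  have h := hasFDerivAt_ringInverse (𝕜 := ℝ) u
  rw [hu] at h
  have h2 := h.comp_hasDerivWithinAt t hF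
  have e : (↑u⁻¹ : Matrix (Fin k) (Fin k) ℝ) = (F t)⁻¹ := by
    rw [← hu, Matrix.coe_units_inv]
  simp only [Matrix.nonsing_inv_eq_ringInverse] at e ⊢
  simpa [e, Function.comp_def] using h2

theorem ContinuousOn.matrix_inv {k : ℕ} {F : ℝ → Matrix (Fin k) (Fin k) ℝ}
    {s : Set ℝ} (hF : ContinuousOn F s) (hu : ∀ t ∈ s, IsUnit (F t)) :
    ContinuousOn (fun r => (F r)⁻¹) s := by
  intro t ht
  obtain ⟨u, hu⟩ := hu t ht
  have h := NormedRing.inverse_continuousAt u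
  rw [hu] at h
  simp only [Matrix.nonsing_inv_eq_ringInverse]
  exact h.comp_continuousWithinAt (hF t ht)

/-! ### Quadratic forms, the Loewner order and squared norm bounds. -/

theorem dotProduct_self_nonneg' {ι : Type*} [Fintype ι] (x : ι → ℝ) : 0 ≤ x ⬝ᵥ x :=
  Finset.sum_nonneg fun i _ => mul_self_nonneg (x i)

theorem dotProduct_sq_le {ι : Type*} [Fintype ι] (x y : ι → ℝ) :
    (x ⬝ᵥ y) ^ 2 ≤ (x ⬝ᵥ x) * (y ⬝ᵥ y) := by
  have := Finset.sum_mul_sq_le_sq_mul_sq Finset.univ x y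
  simpa [dotProduct, sq] using this

theorem dotProduct_le_of_sq_le {ι : Type*} [Fintype ι] {x y : ι → ℝ} {a b : ℝ} (ha : 0 ≤ a)
    (hb : 0 ≤ b) (hx : x ⬝ᵥ x ≤ a ^ 2) (hy : y ⬝ᵥ y ≤ b ^ 2) : x ⬝ᵥ y ≤ a * b := by
  refine le_of_sq_le_sq ?_ (by positivity)
  calc (x ⬝ᵥ y) ^ 2 ≤ (x ⬝ᵥ x) * (y ⬝ᵥ y) := dotProduct_sq_le x y
    _ ≤ a ^ 2 * b ^ 2 := by
      gcongr
      exact dotProduct_self_nonneg' y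
    _ = (a * b) ^ 2 := by ring

theorem mulVec_sq_le {k l : ℕ} {M : Matrix (Fin k) (Fin l) ℝ} {c : ℝ} (hM : ‖M‖ ≤ c)
    (x : Fin l → ℝ) : (M *ᵥ x) ⬝ᵥ (M *ᵥ x) ≤ c ^ 2 * (x ⬝ᵥ x) := by
  have h := Matrix.l2_opNorm_mulVec M (WithLp.toLp 2 x)
  have h0 : ∀ {j : ℕ} (y : Fin j → ℝ), y ⬝ᵥ y = ‖WithLp.toLp 2 y‖ ^ 2 := by
    intro j y
    rw [EuclideanSpace.norm_sq_eq]
    simp [dotProduct, sq]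
  rw [h0, h0, ← mul_pow]
  exact pow_le_pow_left₀ (norm_nonneg _) (h.trans (by gcongr)) 2

theorem norm_transpose_eq {k l : ℕ} (M : Matrix (Fin k) (Fin l) ℝ) : ‖Mᵀ‖ = ‖M‖ := by
  rw [← Matrix.l2_opNorm_conjTranspose M, Matrix.conjTranspose_eq_transpose_of_trivial]

theorem dotProduct_mulVec_le {k l : ℕ} {M : Matrix (Fin k) (Fin l) ℝ} {c : ℝ} (hc : 0 ≤ c)
    (hM : ∀ x, (M *ᵥ x) ⬝ᵥ (M *ᵥ x) ≤ c ^ 2 * (x ⬝ᵥ x))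
    (y : Fin k → ℝ) (x : Fin l → ℝ) :
    y ⬝ᵥ M *ᵥ x ≤ c * (√(y ⬝ᵥ y) * √(x ⬝ᵥ x)) := by
  have hx := dotProduct_self_nonneg' x
  have hy := dotProduct_self_nonneg' y
  have := dotProduct_le_of_sq_le (x := y) (y := M *ᵥ x) (a := √(y ⬝ᵥ y)) (b := c * √(x ⬝ᵥ x))
    (by positivity) (by positivity) (by rw [Real.sq_sqrt hy])
    (by rw [mul_pow, Real.sq_sqrt hx]; exact hM x)
  linarith

theorem abs_dotProduct_mulVec_self_le {k : ℕ} {M : Matrix (Fin k) (Fin k) ℝ} {c : ℝ}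
    (hc : 0 ≤ c) (hM : ∀ x, (M *ᵥ x) ⬝ᵥ (M *ᵥ x) ≤ c ^ 2 * (x ⬝ᵥ x)) (x : Fin k → ℝ) :
    |x ⬝ᵥ M *ᵥ x| ≤ c * (x ⬝ᵥ x) := by
  have hx := dotProduct_self_nonneg' x
  have h1 := dotProduct_mulVec_le hc hM x x
  have h2 := dotProduct_mulVec_le (M := -M) hc
    (fun x => by rw [Matrix.neg_mulVec, neg_dotProduct_neg]; exact hM x) x x
  rw [Real.mul_self_sqrt hx] at h1 h2
  rw [Matrix.neg_mulVec, dotProduct_neg] at h2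
  rw [abs_le]
  constructor <;> linarith

theorem dotProduct_mulVec_transpose {k l : ℕ} (M : Matrix (Fin k) (Fin l) ℝ) (x : Fin k → ℝ)
    (y : Fin l → ℝ) : y ⬝ᵥ Mᵀ *ᵥ x = x ⬝ᵥ M *ᵥ y := by
  rw [Matrix.mulVec_transpose, dotProduct_comm, ← Matrix.dotProduct_mulVec]

theorem dotProduct_mulVec_comm {k : ℕ} {M : Matrix (Fin k) (Fin k) ℝ} (hM : Mᵀ = M)
    (x y : Fin k → ℝ) : y ⬝ᵥ M *ᵥ x = x ⬝ᵥ M *ᵥ y := by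
  rw [← dotProduct_mulVec_transpose, hM]

theorem matrix_le_iff {k : ℕ} {M N : Matrix (Fin k) (Fin k) ℝ} :
    M ≤ N ↔ (N - M)ᵀ = N - M ∧ ∀ x, x ⬝ᵥ M *ᵥ x ≤ x ⬝ᵥ N *ᵥ x := by
  rw [Matrix.le_iff, Matrix.posSemidef_iff_dotProduct_mulVec, Matrix.IsHermitian,
    Matrix.conjTranspose_eq_transpose_of_trivial]
  simp [Matrix.sub_mulVec]

theorem smul_one_le_iff {k : ℕ} {M : Matrix (Fin k) (Fin k) ℝ} {c : ℝ} :
    c • (1 : Matrix (Fin k) (Fin k) ℝ) ≤ M ↔ Mᵀ = M ∧ ∀ x, c * (x ⬝ᵥ x) ≤ x ⬝ᵥ M *ᵥ x := by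
  rw [matrix_le_iff]
  simp [Matrix.smul_mulVec]

theorem le_smul_one_iff {k : ℕ} {M : Matrix (Fin k) (Fin k) ℝ} {c : ℝ} :
    M ≤ c • (1 : Matrix (Fin k) (Fin k) ℝ) ↔ Mᵀ = M ∧ ∀ x, x ⬝ᵥ M *ᵥ x ≤ c * (x ⬝ᵥ x) := by
  rw [matrix_le_iff]
  simp [Matrix.smul_mulVec]

theorem isUnit_of_coercive {k : ℕ} {M : Matrix (Fin k) (Fin k) ℝ} {c : ℝ} (hc : 0 < c)
    (hM : ∀ x, c * (x ⬝ᵥ x) ≤ x ⬝ᵥ M *ᵥ x) : IsUnit M := by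
  rw [← Matrix.mulVec_injective_iff_isUnit]
  intro x y hxy
  have h := hM (x - y)
  have h0 : M *ᵥ (x - y) = 0 := by rw [Matrix.mulVec_sub]; exact sub_eq_zero.2 hxy
  rw [h0, dotProduct_zero] at h
  have : (x - y) ⬝ᵥ (x - y) = 0 :=
    le_antisymm (by nlinarith) (dotProduct_self_nonneg' _)
  exact sub_eq_zero.1 (dotProduct_self_eq_zero.1 this)

theorem mulVec_inv_mulVec {k : ℕ} {M : Matrix (Fin k) (Fin k) ℝ} (hM : IsUnit M)
    (x : Fin k → ℝ) : M *ᵥ (M⁻¹ *ᵥ x) = x := by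
  rw [Matrix.mulVec_mulVec, Matrix.mul_nonsing_inv _ ((Matrix.isUnit_iff_isUnit_det _).1 hM),
    Matrix.one_mulVec]

/-- The inverse of a matrix bounded below by `c` expands by at most `1 / c`. -/
theorem inv_mulVec_sq_le {k : ℕ} {M : Matrix (Fin k) (Fin k) ℝ} {c : ℝ} (hc : 0 < c)
    (hM : ∀ x, c * (x ⬝ᵥ x) ≤ x ⬝ᵥ M *ᵥ x) (x : Fin k → ℝ) :
    (M⁻¹ *ᵥ x) ⬝ᵥ (M⁻¹ *ᵥ x) ≤ (1 / c) ^ 2 * (x ⬝ᵥ x) := by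
  have h := hM (M⁻¹ *ᵥ x)
  rw [mulVec_inv_mulVec (isUnit_of_coercive hc hM)] at h
  have h2 := dotProduct_sq_le (M⁻¹ *ᵥ x) x
  set a := (M⁻¹ *ᵥ x) ⬝ᵥ (M⁻¹ *ᵥ x)
  set b := x ⬝ᵥ x
  have ha : 0 ≤ a := dotProduct_self_nonneg' _
  have hb : 0 ≤ b := dotProduct_self_nonneg' _
  have h3 : (c * a) ^ 2 ≤ a * b := (pow_le_pow_left₀ (by positivity) h 2).trans h2
  rcases ha.eq_or_lt with h0 | h0
  · rw [← h0]; positivity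
  · have : c ^ 2 * a ≤ b := le_of_mul_le_mul_left (by nlinarith) h0
    rw [div_pow, one_pow, div_mul_eq_mul_div, one_mul, le_div_iff₀ (by positivity)]
    linarith

theorem dotProduct_inv_mulVec_le {k : ℕ} {M : Matrix (Fin k) (Fin k) ℝ} {c : ℝ} (hc : 0 < c)
    (hM : ∀ x, c * (x ⬝ᵥ x) ≤ x ⬝ᵥ M *ᵥ x) (x : Fin k → ℝ) :
    x ⬝ᵥ M⁻¹ *ᵥ x ≤ 1 / c * (x ⬝ᵥ x) := by
  have hx := dotProduct_self_nonneg' x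
  have h1 := dotProduct_mulVec_le (by positivity) (inv_mulVec_sq_le hc hM) x x
  rwa [Real.mul_self_sqrt hx] at h1

theorem dotProduct_inv_mulVec_nonneg {k : ℕ} {M : Matrix (Fin k) (Fin k) ℝ} {c : ℝ} (hc : 0 < c)
    (hM : ∀ x, c * (x ⬝ᵥ x) ≤ x ⬝ᵥ M *ᵥ x) (x : Fin k → ℝ) : 0 ≤ x ⬝ᵥ M⁻¹ *ᵥ x := by
  have h := hM (M⁻¹ *ᵥ x)
  rw [mulVec_inv_mulVec (isUnit_of_coercive hc hM), dotProduct_comm _ x] at h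
  have := dotProduct_self_nonneg' (M⁻¹ *ᵥ x)
  nlinarith

/-- With `y = M x`, nonnegativity of the form at `y - c x` gives `2 c |y|² ≤ y · M y + c² (x · M
x)`, and both terms on the right are bounded by hypothesis. No spectral theory is needed. -/
theorem mulVec_sq_le_of_le {k : ℕ} {M : Matrix (Fin k) (Fin k) ℝ} {c : ℝ} (hMs : Mᵀ = M)
    (hc : 0 < c) (h0 : ∀ x, 0 ≤ x ⬝ᵥ M *ᵥ x) (hM : ∀ x, x ⬝ᵥ M *ᵥ x ≤ c * (x ⬝ᵥ x))
    (x : Fin k → ℝ) : (M *ᵥ x) ⬝ᵥ (M *ᵥ x) ≤ c ^ 2 * (x ⬝ᵥ x) := by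
  set y := M *ᵥ x with hy
  have h1 := h0 (y - c • x)
  have h2 := hM y
  have h3 := hM x
  have e := dotProduct_mulVec_comm hMs x y
  simp only [Matrix.mulVec_sub, Matrix.mulVec_smul, dotProduct_sub, sub_dotProduct,
    smul_dotProduct, dotProduct_smul, smul_eq_mul, ← hy] at h1 e h2 h3
  have h4 : c * (y ⬝ᵥ y) ≤ c * (c ^ 2 * (x ⬝ᵥ x)) := by nlinarith
  exact le_of_mul_le_mul_left h4 hc

/-! ### Monotonicity and growth of linear trajectories. -/

/-- Replaces integration in the later estimates: a quantity plus an explicit primitive of its bound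
is shown to be monotone. Derivatives are asked only in the open interval, which suits Riccati
solutions that are merely continuous at `T`. -/
theorem le_of_hasDerivWithinAt_nonneg {T a b : ℝ} {f f' : ℝ → ℝ} (ha : 0 ≤ a) (hab : a ≤ b)
    (hb : b ≤ T) (hc : ContinuousOn f (Icc a b))
    (hf : ∀ t ∈ Ioo a b, HasDerivWithinAt f (f' t) (Icc 0 T) t) (h : ∀ t ∈ Ioo a b, 0 ≤ f' t) :
    f a ≤ f b := by
  have hd : ∀ t ∈ Ioo a b, HasDerivAt f (f' t) t := fun t ht =>
    (hf t ht).hasDerivAt (Icc_mem_nhds (ha.trans_lt ht.1) (ht.2.trans_le hb))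
  refine monotoneOn_of_deriv_nonneg (convex_Icc a b) hc ?_ ?_ (left_mem_Icc.2 hab)
    (right_mem_Icc.2 hab) hab
  · rw [interior_Icc]
    exact fun t ht => (hd t ht).differentiableAt.differentiableWithinAt
  · rw [interior_Icc]
    intro t ht
    rw [(hd t ht).deriv]
    exact h t ht

theorem eq_of_hasDerivWithinAt_zero {T a b : ℝ} {f : ℝ → ℝ} (ha : 0 ≤ a) (hab : a ≤ b)
    (hb : b ≤ T) (hc : ContinuousOn f (Icc a b))
    (hf : ∀ t ∈ Ioo a b, HasDerivWithinAt f 0 (Icc 0 T) t) : f a = f b := by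
  refine le_antisymm (le_of_hasDerivWithinAt_nonneg ha hab hb hc hf fun _ _ => le_rfl) ?_
  have := le_of_hasDerivWithinAt_nonneg ha hab hb hc.neg (f' := fun _ => 0)
    (fun t ht => by simpa using (hf t ht).neg) fun _ _ => le_rfl
  simpa using this

/-- Since `d/dt |z|² = 2 z · A z` lies between `±2 K |z|²`, the product `exp (-2 K r) |z|²`
decreases and `exp (2 K r) |z|²` increases. -/
theorem trajectory_growth {k : ℕ} {T K a b : ℝ} {A : ℝ → Matrix (Fin k) (Fin k) ℝ}
    {z : ℝ → Fin k → ℝ} (hA : ∀ t ∈ Icc 0 T, ∀ x, |x ⬝ᵥ A t *ᵥ x| ≤ K * (x ⬝ᵥ x))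
    (hz : ∀ t ∈ Icc 0 T, HasDerivWithinAt z (A t *ᵥ z t) (Icc 0 T) t)
    (ha : 0 ≤ a) (hab : a ≤ b) (hb : b ≤ T) :
    z b ⬝ᵥ z b ≤ Real.exp (2 * K * (b - a)) * (z a ⬝ᵥ z a) ∧
    z a ⬝ᵥ z a ≤ Real.exp (2 * K * (b - a)) * (z b ⬝ᵥ z b) := by
  have hsub : Icc a b ⊆ Icc 0 T := Icc_subset_Icc ha hb
  have hd : ∀ c : ℝ, ∀ t ∈ Icc 0 T, HasDerivWithinAt
      (fun r => Real.exp (c * r) * (z r ⬝ᵥ z r))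
      (Real.exp (c * t) * (c * (z t ⬝ᵥ z t) + 2 * (z t ⬝ᵥ A t *ᵥ z t))) (Icc 0 T) t := by
    intro c t ht
    have h1 : HasDerivWithinAt (fun r => Real.exp (c * r)) (Real.exp (c * t) * (c * 1))
        (Icc 0 T) t := ((hasDerivWithinAt_id t _).const_mul c).exp
    refine (h1.mul ((hz t ht).dotProduct (hz t ht))).congr_deriv ?_
    rw [dotProduct_comm (A t *ᵥ z t)]
    ring
  constructor
  · have h := le_of_hasDerivWithinAt_nonneg ha hab hb
      (fun t ht => ((hd (-(2 * K)) t (hsub ht)).neg.continuousWithinAt.mono hsub))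
      (fun t ht => (hd (-(2 * K)) t (hsub (Ioo_subset_Icc_self ht))).neg) (fun t ht => ?_)
    · simp only [Pi.neg_apply, neg_le_neg_iff] at h
      calc z b ⬝ᵥ z b = Real.exp (2 * K * b) * (Real.exp (-(2 * K) * b) * (z b ⬝ᵥ z b)) := by
            rw [← mul_assoc, ← Real.exp_add]; simp
        _ ≤ Real.exp (2 * K * b) * (Real.exp (-(2 * K) * a) * (z a ⬝ᵥ z a)) := by gcongr
        _ = _ := by rw [← mul_assoc, ← Real.exp_add]; ring_nf
    · have := (abs_le.1 (hA t (hsub (Ioo_subset_Icc_self ht)) (z t))).2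
      have := Real.exp_pos (-(2 * K) * t)
      nlinarith
  · have h := le_of_hasDerivWithinAt_nonneg ha hab hb
      (fun t ht => ((hd (2 * K) t (hsub ht)).continuousWithinAt.mono hsub))
      (fun t ht => (hd (2 * K) t (hsub (Ioo_subset_Icc_self ht)))) (fun t ht => ?_)
    · calc z a ⬝ᵥ z a = Real.exp (-(2 * K) * a) * (Real.exp (2 * K * a) * (z a ⬝ᵥ z a)) := by
            rw [← mul_assoc, ← Real.exp_add]; simp
        _ ≤ Real.exp (-(2 * K) * a) * (Real.exp (2 * K * b) * (z b ⬝ᵥ z b)) := by gcongr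
        _ = _ := by rw [← mul_assoc, ← Real.exp_add]; ring_nf
    · have := (abs_le.1 (hA t (hsub (Ioo_subset_Icc_self ht)) (z t))).1
      have := Real.exp_pos (2 * K * t)
      refine mul_nonneg this.le ?_
      linarith

theorem exists_quadratic_bound {k : ℕ} {T : ℝ} {A : ℝ → Matrix (Fin k) (Fin k) ℝ}
    (hA : ContinuousOn A (Icc 0 T)) :
    ∃ K, ∀ t ∈ Icc 0 T, ∀ x, |x ⬝ᵥ A t *ᵥ x| ≤ K * (x ⬝ᵥ x) := by
  obtain ⟨K, hK⟩ := isCompact_Icc.exists_bound_of_continuousOn hA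
  exact ⟨K, fun t ht x => abs_dotProduct_mulVec_self_le
    ((norm_nonneg _).trans (hK t ht)) (mulVec_sq_le (hK t ht)) x⟩

theorem trajectory_eq_zero {k : ℕ} {T s r : ℝ} {A : ℝ → Matrix (Fin k) (Fin k) ℝ}
    (hA : ContinuousOn A (Icc 0 T)) {z : ℝ → Fin k → ℝ}
    (hz : ∀ t ∈ Icc 0 T, HasDerivWithinAt z (A t *ᵥ z t) (Icc 0 T) t)
    (hs : s ∈ Icc 0 T) (hr : r ∈ Icc 0 T) (h0 : z s = 0) : z r = 0 := by
  obtain ⟨K, hK⟩ := exists_quadratic_bound hA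
  refine dotProduct_self_eq_zero.1 (le_antisymm ?_ (dotProduct_self_nonneg' _))
  rcases le_total s r with h | h
  · simpa [h0] using (trajectory_growth hK hz hs.1 h hr.2).1
  · simpa [h0] using (trajectory_growth hK hz hr.1 h hs.2).2

/-! ### The evolution operator. -/

theorem evolutionOperator_trajectory {k : ℕ} {T s t : ℝ} {A : ℝ → Matrix (Fin k) (Fin k) ℝ}
    (hA : ContinuousOn A (Icc 0 T)) (hs : s ∈ Icc 0 T) (ht : t ∈ Icc 0 T) (ξ : Fin k → ℝ) :
    HasDerivWithinAt (fun r => evolutionOperator A r s *ᵥ ξ)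
      (A t *ᵥ (evolutionOperator A t s *ᵥ ξ)) (Icc 0 T) t := by
  rw [Matrix.mulVec_mulVec]
  exact (evolutionOperator_hasDerivWithinAt hA hs ht).matrix_mulVec_const ξ

/-- Both `Φ(·, s) Φ(s, t) ξ` and `Φ(·, t) ξ` solve the system and agree at `s`, hence also at `t`.
-/
theorem evolutionOperator_mul_symm {k : ℕ} {T s t : ℝ} {A : ℝ → Matrix (Fin k) (Fin k) ℝ}
    (hA : ContinuousOn A (Icc 0 T)) (hs : s ∈ Icc 0 T) (ht : t ∈ Icc 0 T) :
    evolutionOperator A t s * evolutionOperator A s t = 1 := by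
  refine Matrix.mulVec_injective (funext fun ξ => ?_)
  have h := trajectory_eq_zero (s := s) (r := t) hA
    (z := fun r => evolutionOperator A r s *ᵥ (evolutionOperator A s t *ᵥ ξ)
      - evolutionOperator A r t *ᵥ ξ)
    (fun r hr => by
      rw [Matrix.mulVec_sub]
      exact (evolutionOperator_trajectory hA hs hr _).sub (evolutionOperator_trajectory hA ht hr _))
    hs ht (by simp [evolutionOperator_self])
  rw [sub_eq_zero, evolutionOperator_self, Matrix.mulVec_mulVec] at h
  exact h

theorem evolutionOperator_continuousOn {k : ℕ} {T s : ℝ} {A : ℝ → Matrix (Fin k) (Fin k) ℝ}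
    (hA : ContinuousOn A (Icc 0 T)) (hs : s ∈ Icc 0 T) :
    ContinuousOn (fun r => evolutionOperator A r s) (Icc 0 T) :=
  fun _ ht => (evolutionOperator_hasDerivWithinAt hA hs ht).continuousWithinAt

/-- The series controls only the first argument; continuity in the second comes from `Φ(s, r) = Φ(r,
s)⁻¹`. The Gramian integrand needs it. -/
theorem evolutionOperator_continuousOn_right {k : ℕ} {T s : ℝ}
    {A : ℝ → Matrix (Fin k) (Fin k) ℝ} (hA : ContinuousOn A (Icc 0 T)) (hs : s ∈ Icc 0 T) :
    ContinuousOn (fun r => evolutionOperator A s r) (Icc 0 T) := by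
  refine ((evolutionOperator_continuousOn hA hs).matrix_inv fun t ht => ?_).congr fun t ht => ?_
  · exact .of_mul_eq_one _ (evolutionOperator_mul_symm hA hs ht)
  · exact (Matrix.inv_eq_right_inv (evolutionOperator_mul_symm hA hs ht)).symm

/-! ### The controllability Gramian as a function of its endpoint. -/

theorem gramian_hasDerivWithinAt {k l : ℕ} {T s t : ℝ} {A : ℝ → Matrix (Fin k) (Fin k) ℝ}
    {B : ℝ → Matrix (Fin k) (Fin l) ℝ} (hA : ContinuousOn A (Icc 0 T))
    (hB : ContinuousOn B (Icc 0 T)) (hs : s ∈ Icc 0 T) (ht : t ∈ Icc 0 T) :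
    HasDerivWithinAt (fun r => gramian A B s r)
      (evolutionOperator A s t * B t * (B t)ᵀ * (evolutionOperator A s t)ᵀ) (Icc 0 T) t := by
  have hΦ := evolutionOperator_continuousOn_right hA hs
  have hf : ContinuousOn (fun r => evolutionOperator A s r * B r * (B r)ᵀ *
    (evolutionOperator A s r)ᵀ) (Icc 0 T) := by fun_prop
  have : Fact (t ∈ Icc 0 T) := ⟨ht⟩
  apply intervalIntegral.integral_hasDerivWithinAt_right
  · exact (hf.mono (uIcc_subset_Icc hs ht)).intervalIntegrable
  · exact hf.stronglyMeasurableAtFilter_nhdsWithin measurableSet_Icc t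
  · exact hf t ht

theorem gramian_self {k l : ℕ} (A : ℝ → Matrix (Fin k) (Fin k) ℝ)
    (B : ℝ → Matrix (Fin k) (Fin l) ℝ) (s : ℝ) : gramian A B s s = 0 :=
  intervalIntegral.integral_same

theorem gramian_form_hasDerivWithinAt {k l : ℕ} {T s t : ℝ} {A : ℝ → Matrix (Fin k) (Fin k) ℝ}
    {B : ℝ → Matrix (Fin k) (Fin l) ℝ} (hA : ContinuousOn A (Icc 0 T))
    (hB : ContinuousOn B (Icc 0 T)) (hs : s ∈ Icc 0 T) (ht : t ∈ Icc 0 T) (x y : Fin k → ℝ) :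
    HasDerivWithinAt (fun r => x ⬝ᵥ gramian A B s r *ᵥ y)
      (((B t)ᵀ *ᵥ ((evolutionOperator A s t)ᵀ *ᵥ x)) ⬝ᵥ
        ((B t)ᵀ *ᵥ ((evolutionOperator A s t)ᵀ *ᵥ y))) (Icc 0 T) t := by
  have h := (hasDerivWithinAt_const t (Icc 0 T) x).dotProduct
    ((gramian_hasDerivWithinAt hA hB hs ht).matrix_mulVec_const y)
  refine h.congr_deriv ?_
  rw [zero_dotProduct, zero_add, ← Matrix.mulVec_mulVec, ← Matrix.mulVec_mulVec,
    ← Matrix.mulVec_mulVec, ← dotProduct_mulVec_transpose, dotProduct_comm, ← dotProduct_mulVec_transpose, dotProduct_comm]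

/-- By Cauchy-Schwarz, `|Mᵀ y|⁴ = (y · M Mᵀ y)² ≤ |y|² c² |Mᵀ y|²`; then one factor `|Mᵀ y|²`
cancels. -/
theorem transpose_mulVec_sq_le {k l : ℕ} {M : Matrix (Fin k) (Fin l) ℝ} {c : ℝ}
    (hM : ∀ x, (M *ᵥ x) ⬝ᵥ (M *ᵥ x) ≤ c ^ 2 * (x ⬝ᵥ x)) (y : Fin k → ℝ) :
    (Mᵀ *ᵥ y) ⬝ᵥ (Mᵀ *ᵥ y) ≤ c ^ 2 * (y ⬝ᵥ y) := by
  have h := dotProduct_sq_le y (M *ᵥ (Mᵀ *ᵥ y))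
  rw [← dotProduct_mulVec_transpose] at h
  have h2 := hM (Mᵀ *ᵥ y)
  set a := (Mᵀ *ᵥ y) ⬝ᵥ (Mᵀ *ᵥ y)
  have ha : 0 ≤ a := dotProduct_self_nonneg' _
  have hy := dotProduct_self_nonneg' y
  rcases ha.eq_or_lt with h0 | h0
  · rw [← h0]; positivity
  · have h3 : a * a ≤ a * (c ^ 2 * (y ⬝ᵥ y)) := by
      calc a * a = a ^ 2 := by ring
        _ ≤ _ := h
        _ ≤ (y ⬝ᵥ y) * (c ^ 2 * a) := by gcongr
        _ = _ := by ring
    exact le_of_mul_le_mul_left h3 h0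

theorem evolutionOperator_mulVec_sq_le {k : ℕ} {T K s t : ℝ} {A : ℝ → Matrix (Fin k) (Fin k) ℝ}
    (hA : ContinuousOn A (Icc 0 T)) (hK : ∀ t ∈ Icc 0 T, ∀ x, |x ⬝ᵥ A t *ᵥ x| ≤ K * (x ⬝ᵥ x))
    (hs : s ∈ Icc 0 T) (ht : t ∈ Icc 0 T) (hst : s ≤ t) (x : Fin k → ℝ) :
    (evolutionOperator A t s *ᵥ x) ⬝ᵥ (evolutionOperator A t s *ᵥ x) ≤
      Real.exp (2 * K * (t - s)) * (x ⬝ᵥ x) ∧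
    (evolutionOperator A s t *ᵥ x) ⬝ᵥ (evolutionOperator A s t *ᵥ x) ≤
      Real.exp (2 * K * (t - s)) * (x ⬝ᵥ x) ∧
    ((evolutionOperator A s t)ᵀ *ᵥ x) ⬝ᵥ ((evolutionOperator A s t)ᵀ *ᵥ x) ≤
      Real.exp (2 * K * (t - s)) * (x ⬝ᵥ x) := by
  have h1 : ∀ x, (evolutionOperator A t s *ᵥ x) ⬝ᵥ (evolutionOperator A t s *ᵥ x) ≤
      Real.exp (2 * K * (t - s)) * (x ⬝ᵥ x) := fun x => by
    have := (trajectory_growth hK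
      (fun r hr => evolutionOperator_trajectory hA hs hr x) hs.1 hst ht.2).1
    rwa [evolutionOperator_self, Matrix.one_mulVec] at this
  have h2 : ∀ x, (evolutionOperator A s t *ᵥ x) ⬝ᵥ (evolutionOperator A s t *ᵥ x) ≤
      Real.exp (2 * K * (t - s)) * (x ⬝ᵥ x) := fun x => by
    have := (trajectory_growth hK
      (fun r hr => evolutionOperator_trajectory hA ht hr x) hs.1 hst ht.2).2
    rwa [evolutionOperator_self, Matrix.one_mulVec] at this
  refine ⟨h1 x, h2 x, ?_⟩
  have e : Real.exp (2 * K * (t - s)) = Real.exp (K * (t - s)) ^ 2 := by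
    rw [← Real.exp_nat_mul]; push_cast; ring_nf
  rw [e] at h2 ⊢
  exact transpose_mulVec_sq_le h2 x

theorem gramian_transpose {k l : ℕ} {T s t : ℝ} {A : ℝ → Matrix (Fin k) (Fin k) ℝ}
    {B : ℝ → Matrix (Fin k) (Fin l) ℝ} (hA : ContinuousOn A (Icc 0 T))
    (hB : ContinuousOn B (Icc 0 T)) (hs : s ∈ Icc 0 T) (ht : t ∈ Icc 0 T) (hst : s ≤ t) :
    (gramian A B s t)ᵀ = gramian A B s t := by
  ext i j
  have hd : ∀ i j, ∀ r ∈ Icc 0 T, HasDerivWithinAt (fun r => gramian A B s r i j) _ (Icc 0 T) r :=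
    fun i j r hr => (gramian_hasDerivWithinAt hA hB hs hr).matrix_apply i j
  have hsub : Icc s t ⊆ Icc 0 T := Icc_subset_Icc hs.1 ht.2
  have h := eq_of_hasDerivWithinAt_zero (f := fun r => gramian A B s r j i - gramian A B s r i j)
    hs.1 hst ht.2
    (fun r hr => ((hd j i r (hsub hr)).sub (hd i j r (hsub hr))).continuousWithinAt.mono hsub)
    (fun r hr => (((hd j i r (hsub (Ioo_subset_Icc_self hr))).sub
      (hd i j r (hsub (Ioo_subset_Icc_self hr)))).congr_deriv ?_))
  · simp only [gramian_self, Matrix.zero_apply, sub_zero] at h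
    exact sub_eq_zero.1 h.symm
  · have e : (evolutionOperator A s r * B r * (B r)ᵀ * (evolutionOperator A s r)ᵀ)ᵀ =
        evolutionOperator A s r * B r * (B r)ᵀ * (evolutionOperator A s r)ᵀ := by
      simp [Matrix.transpose_mul, Matrix.mul_assoc]
    exact sub_eq_zero.2 (congrFun (congrFun e i) j)

theorem gramian_form_mono {k l : ℕ} {T s t r : ℝ} {A : ℝ → Matrix (Fin k) (Fin k) ℝ}
    {B : ℝ → Matrix (Fin k) (Fin l) ℝ} (hA : ContinuousOn A (Icc 0 T))
    (hB : ContinuousOn B (Icc 0 T)) (hs : 0 ≤ s) (hst : s ≤ t) (htr : t ≤ r) (hr : r ≤ T)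
    (x : Fin k → ℝ) :
    x ⬝ᵥ gramian A B s t *ᵥ x ≤ x ⬝ᵥ gramian A B s r *ᵥ x := by
  have hs' : s ∈ Icc 0 T := ⟨hs, hst.trans (htr.trans hr)⟩
  have hsub : Icc t r ⊆ Icc 0 T := Icc_subset_Icc (hs.trans hst) hr
  exact le_of_hasDerivWithinAt_nonneg (hs.trans hst) htr hr
    (fun q hq => (gramian_form_hasDerivWithinAt hA hB hs' (hsub hq) x x).continuousWithinAt.mono
      hsub)
    (fun q hq => gramian_form_hasDerivWithinAt hA hB hs' (hsub (Ioo_subset_Icc_self hq)) x x)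
    (fun q _ => dotProduct_self_nonneg' _)

theorem gramian_form_nonneg {k l : ℕ} {T s t : ℝ} {A : ℝ → Matrix (Fin k) (Fin k) ℝ}
    {B : ℝ → Matrix (Fin k) (Fin l) ℝ} (hA : ContinuousOn A (Icc 0 T))
    (hB : ContinuousOn B (Icc 0 T)) (hs : 0 ≤ s) (hst : s ≤ t) (ht : t ≤ T)
    (x : Fin k → ℝ) : 0 ≤ x ⬝ᵥ gramian A B s t *ᵥ x := by
  have := gramian_form_mono hA hB hs le_rfl hst ht x
  simpa [gramian_self] using this

theorem hasDerivWithinAt_exp_div {s : Set ℝ} {t c a : ℝ} (hc : c ≠ 0) :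
    HasDerivWithinAt (fun r => (Real.exp (c * (r - a)) - 1) / c) (Real.exp (c * (t - a))) s t := by
  have h1 : HasDerivWithinAt (fun r => Real.exp (c * (r - a))) (Real.exp (c * (t - a)) * (c * 1))
      s t := (((hasDerivWithinAt_id t _).sub_const a).const_mul c).exp
  refine ((h1.sub_const 1).div_const c).congr_deriv ?_
  field_simp

theorem gramian_form_le {k l : ℕ} {T K b s t : ℝ} {A : ℝ → Matrix (Fin k) (Fin k) ℝ}
    {B : ℝ → Matrix (Fin k) (Fin l) ℝ} (hA : ContinuousOn A (Icc 0 T))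
    (hB : ContinuousOn B (Icc 0 T)) (hK0 : 0 < K)
    (hK : ∀ t ∈ Icc 0 T, ∀ x, |x ⬝ᵥ A t *ᵥ x| ≤ K * (x ⬝ᵥ x))
    (hb : ∀ t ∈ Icc 0 T, ‖B t‖ ≤ b) (hs : 0 ≤ s) (hst : s ≤ t) (ht : t ≤ T)
    (x : Fin k → ℝ) :
    x ⬝ᵥ gramian A B s t *ᵥ x ≤
      b ^ 2 * ((Real.exp (2 * K * (t - s)) - 1) / (2 * K)) * (x ⬝ᵥ x) := by
  have hs' : s ∈ Icc 0 T := ⟨hs, hst.trans ht⟩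
  have hsub : Icc s t ⊆ Icc 0 T := Icc_subset_Icc hs ht
  have hd : ∀ r ∈ Icc 0 T, HasDerivWithinAt (fun r =>
      b ^ 2 * ((Real.exp (2 * K * (r - s)) - 1) / (2 * K)) * (x ⬝ᵥ x) - x ⬝ᵥ gramian A B s r *ᵥ x)
      _ (Icc 0 T) r := fun r hr =>
    (((hasDerivWithinAt_exp_div (a := s) (by positivity)).const_mul (b ^ 2)).mul_const
      (x ⬝ᵥ x)).sub (gramian_form_hasDerivWithinAt hA hB hs' hr x x)
  have h := le_of_hasDerivWithinAt_nonneg hs hst ht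
    (fun r hr => (hd r (hsub hr)).continuousWithinAt.mono hsub)
    (fun r hr => hd r (hsub (Ioo_subset_Icc_self hr))) (fun r hr => ?_)
  · simp only [sub_self, mul_zero, Real.exp_zero, zero_div, zero_mul, gramian_self,
      Matrix.zero_mulVec, dotProduct_zero] at h
    linarith
  · have hr' := hsub (Ioo_subset_Icc_self hr)
    have h1 := mulVec_sq_le (c := b) (M := (B r)ᵀ) (by rw [norm_transpose_eq]; exact hb r hr')
      ((evolutionOperator A s r)ᵀ *ᵥ x)
    have h2 := (evolutionOperator_mulVec_sq_le hA hK hs' hr' hr.1.le x).2.2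
    have h3 : b ^ 2 * (((evolutionOperator A s r)ᵀ *ᵥ x) ⬝ᵥ ((evolutionOperator A s r)ᵀ *ᵥ x)) ≤
      b ^ 2 * (Real.exp (2 * K * (r - s)) * (x ⬝ᵥ x)) := by gcongr
    linarith

/-! ### Existence through the Hamiltonian system. -/

theorem HasDerivWithinAt.matrix_mul_mul_const {k l p q : ℕ} {F : ℝ → Matrix (Fin k) (Fin l) ℝ}
    {F' : Matrix (Fin k) (Fin l) ℝ} {s : Set ℝ} {t : ℝ} (hF : HasDerivWithinAt F F' s t)
    (L : Matrix (Fin p) (Fin k) ℝ) (N : Matrix (Fin l) (Fin q) ℝ) :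
    HasDerivWithinAt (fun r => L * F r * N) (L * F' * N) s t :=
  (LinearMap.toContinuousLinearMap
    ({ toFun := fun M => L * M * N
       map_add' := fun M M' => by rw [Matrix.mul_add, Matrix.add_mul]
       map_smul' := fun c M => by simp } :
      Matrix (Fin k) (Fin l) ℝ →ₗ[ℝ] Matrix (Fin p) (Fin q) ℝ)).hasFDerivAt.comp_hasDerivWithinAt
    t hF

/-- Existence of a solution of the Hamiltonian system `Ẋ = F X - G Y`, `Ẏ = -P X - Fᵀ Y` with
prescribed terminal values. -/
theorem exists_hamiltonian_solution {n : ℕ} {T : ℝ} (hT : 0 ≤ T)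
    {F G P : ℝ → Matrix (Fin n) (Fin n) ℝ} (hF : ContinuousOn F (Icc 0 T))
    (hG : ContinuousOn G (Icc 0 T)) (hP : ContinuousOn P (Icc 0 T))
    (QT : Matrix (Fin n) (Fin n) ℝ) :
    ∃ X Y : ℝ → Matrix (Fin n) (Fin n) ℝ, X T = 1 ∧ Y T = QT ∧
      (∀ t ∈ Icc 0 T, HasDerivWithinAt X (F t * X t - G t * Y t) (Icc 0 T) t) ∧
      ∀ t ∈ Icc 0 T, HasDerivWithinAt Y (-(P t * X t) - (F t)ᵀ * Y t) (Icc 0 T) t := by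
  -- The block system is reindexed by `Fin (n + n)` so that `evolutionOperator` applies; `E₁` and
  -- `E₂` read off the two blocks and `N` is the terminal value.
  let e : Fin n ⊕ Fin n ≃ Fin (n + n) := finSumFinEquiv
  let M : ℝ → Matrix (Fin (n + n)) (Fin (n + n)) ℝ := fun t =>
    (Matrix.fromBlocks (F t) (-G t) (-P t) (-(F t)ᵀ)).submatrix e.symm e.symm
  let E₁ : Matrix (Fin n) (Fin (n + n)) ℝ := (Matrix.fromCols 1 0).submatrix id e.symm
  let E₂ : Matrix (Fin n) (Fin (n + n)) ℝ := (Matrix.fromCols 0 1).submatrix id e.symm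
  let N : Matrix (Fin (n + n)) (Fin n) ℝ := (Matrix.fromRows 1 QT).submatrix e.symm id
  have hM : ContinuousOn M (Icc 0 T) := by
    have h : ContinuousOn (fun t => Matrix.fromBlocks (F t) (-G t) (-P t) (-(F t)ᵀ)) (Icc 0 T) := by
      rw [continuousOn_iff_continuous_domRestrict] at *
      exact hF.matrix_fromBlocks hG.neg hP.neg hF.matrix_transpose.neg
    rw [continuousOn_iff_continuous_domRestrict] at *
    exact h.matrix_submatrix _ _
  have hTm : T ∈ Icc 0 T := ⟨hT, le_rfl⟩
  have h₁ : ∀ t, E₁ * M t = F t * E₁ - G t * E₂ := by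
    intro t
    simp only [E₁, E₂, M]
    rw [Matrix.submatrix_mul_equiv]
    ext i j
    rcases h : e.symm j with j' | j' <;>
      simp [Matrix.mul_apply, h, Matrix.one_apply]
  have h₂ : ∀ t, E₂ * M t = -(P t * E₁) - (F t)ᵀ * E₂ := by
    intro t
    simp only [E₁, E₂, M]
    rw [Matrix.submatrix_mul_equiv]
    ext i j
    rcases h : e.symm j with j' | j' <;>
      simp [Matrix.mul_apply, h, Matrix.one_apply]
  refine ⟨fun t => E₁ * evolutionOperator M t T * N, fun t => E₂ * evolutionOperator M t T * N,
    ?_, ?_, fun t ht => ?_, fun t ht => ?_⟩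
  · simp only [evolutionOperator_self, Matrix.mul_one, E₁, N]
    rw [Matrix.submatrix_mul_equiv, Matrix.fromCols_mul_fromRows]
    simp
  · simp only [evolutionOperator_self, Matrix.mul_one, E₂, N]
    rw [Matrix.submatrix_mul_equiv, Matrix.fromCols_mul_fromRows]
    simp
  · refine ((evolutionOperator_hasDerivWithinAt hM hTm ht).matrix_mul_mul_const E₁
      N).congr_deriv ?_
    rw [← Matrix.mul_assoc E₁, h₁]
    simp only [Matrix.sub_mul, Matrix.mul_assoc]
  · refine ((evolutionOperator_hasDerivWithinAt hM hTm ht).matrix_mul_mul_const E₂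
      N).congr_deriv ?_
    rw [← Matrix.mul_assoc E₂, h₂]
    simp only [Matrix.sub_mul, Matrix.neg_mul, Matrix.mul_assoc]

theorem matrix_ext_of_dotProduct_mulVec {k l : ℕ} {M N : Matrix (Fin k) (Fin l) ℝ}
    (h : ∀ x y, x ⬝ᵥ M *ᵥ y = x ⬝ᵥ N *ᵥ y) : M = N := by
  ext i j
  simpa using h (Pi.single i 1) (Pi.single j 1)

/-- The pairing `X a · Y a` is nonincreasing in time and at `T` is at least `γ |a|²`, so `X t a = 0`
forces `a = 0` and `Y X⁻¹` is defined. Its symmetry is the conservation of `Xᵀ Y - Yᵀ X`, which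
vanishes at `T`. -/
theorem exists_symmetric_riccati_solution {n : ℕ} {T γ : ℝ} (hT : 0 ≤ T) (hγ : 0 < γ)
    {F G P : ℝ → Matrix (Fin n) (Fin n) ℝ} (hF : ContinuousOn F (Icc 0 T))
    (hG : ContinuousOn G (Icc 0 T)) (hP : ContinuousOn P (Icc 0 T))
    (hGs : ∀ t ∈ Icc 0 T, (G t)ᵀ = G t) (hPs : ∀ t ∈ Icc 0 T, (P t)ᵀ = P t)
    (hG0 : ∀ t ∈ Icc 0 T, ∀ x, 0 ≤ x ⬝ᵥ G t *ᵥ x) (hP0 : ∀ t ∈ Icc 0 T, ∀ x, 0 ≤ x ⬝ᵥ P t *ᵥ x)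
    {QT : Matrix (Fin n) (Fin n) ℝ} (hQs : QTᵀ = QT) (hQ : ∀ x, γ * (x ⬝ᵥ x) ≤ x ⬝ᵥ QT *ᵥ x) :
    ∃ S : ℝ → Matrix (Fin n) (Fin n) ℝ, S T = QT ∧ (∀ t ∈ Icc 0 T, (S t)ᵀ = S t) ∧
      ∀ t ∈ Icc 0 T, HasDerivWithinAt S
        (S t * G t * S t - S t * F t - (F t)ᵀ * S t - P t) (Icc 0 T) t := by
  obtain ⟨X, Y, hXT, hYT, hX, hY⟩ := exists_hamiltonian_solution hT hF hG hP QT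
  have hpair : ∀ a b : Fin n → ℝ, ∀ t ∈ Icc 0 T,
      HasDerivWithinAt (fun r => (X r *ᵥ a) ⬝ᵥ (Y r *ᵥ b))
      (-((Y t *ᵥ a) ⬝ᵥ G t *ᵥ (Y t *ᵥ b)) - (X t *ᵥ a) ⬝ᵥ P t *ᵥ (X t *ᵥ b)) (Icc 0 T) t := by
    intro a b t ht
    refine (((hX t ht).matrix_mulVec_const a).dotProduct
      ((hY t ht).matrix_mulVec_const b)).congr_deriv ?_
    simp only [Matrix.sub_mulVec, Matrix.neg_mulVec, ← Matrix.mulVec_mulVec, sub_dotProduct,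
      dotProduct_sub, dotProduct_neg]
    rw [dotProduct_mulVec_transpose, dotProduct_comm (F t *ᵥ _), dotProduct_comm (G t *ᵥ _),
      dotProduct_mulVec_comm (hGs t ht) (Y t *ᵥ a)]
    ring
  have hinj : ∀ t ∈ Icc 0 T, IsUnit (X t) := by
    intro t ht
    rw [← Matrix.mulVec_injective_iff_isUnit]
    intro a b hab
    have hsub : Icc t T ⊆ Icc 0 T := Icc_subset_Icc ht.1 le_rfl
    have h := le_of_hasDerivWithinAt_nonneg ht.1 ht.2 le_rfl
      (fun r hr => (hpair (a - b) (a - b) r (hsub hr)).neg.continuousWithinAt.mono hsub)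
      (fun r hr => (hpair (a - b) (a - b) r (hsub (Ioo_subset_Icc_self hr))).neg) fun r hr => ?_
    · simp only [Pi.neg_apply, hXT, hYT, Matrix.one_mulVec] at h
      rw [Matrix.mulVec_sub (X t), sub_eq_zero.2 hab, zero_dotProduct] at h
      have h2 := hQ (a - b)
      refine sub_eq_zero.1 (dotProduct_self_eq_zero.1
        (le_antisymm ?_ (dotProduct_self_nonneg' _)))
      nlinarith
    · have hr' := hsub (Ioo_subset_Icc_self hr)
      have h1 := hG0 r hr' (Y r *ᵥ (a - b))
      have h2 := hP0 r hr' (X r *ᵥ (a - b))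
      linarith
  have hsymm : ∀ t ∈ Icc 0 T, (X t)ᵀ * Y t = (Y t)ᵀ * X t := by
    intro t ht
    have hsub : Icc t T ⊆ Icc 0 T := Icc_subset_Icc ht.1 le_rfl
    refine matrix_ext_of_dotProduct_mulVec fun a b => ?_
    have h := eq_of_hasDerivWithinAt_zero ht.1 ht.2 le_rfl
      (fun r hr => ((hpair a b r (hsub hr)).sub (hpair b a r (hsub hr))).continuousWithinAt.mono
        hsub)
      (fun r hr => ((hpair a b r (hsub (Ioo_subset_Icc_self hr))).sub
        (hpair b a r (hsub (Ioo_subset_Icc_self hr)))).congr_deriv ?_)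
    · simp only [Pi.sub_apply, hXT, hYT, Matrix.one_mulVec] at h
      rw [dotProduct_mulVec_comm hQs b a, sub_self, sub_eq_zero] at h
      rw [← Matrix.mulVec_mulVec, ← Matrix.mulVec_mulVec, dotProduct_mulVec_transpose,
        dotProduct_mulVec_transpose, dotProduct_comm, h, dotProduct_comm]
    · have hr' := hsub (Ioo_subset_Icc_self hr)
      rw [dotProduct_mulVec_comm (hGs r hr') (Y r *ᵥ a), dotProduct_mulVec_comm (hPs r hr')
        (X r *ᵥ a)]
      ring
  refine ⟨fun t => Y t * (X t)⁻¹, ?_, fun t ht => ?_, fun t ht => ?_⟩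
  · simp [hXT, hYT]
  · have hd := (Matrix.isUnit_iff_isUnit_det _).1 (hinj t ht)
    have hd' : IsUnit ((X t)ᵀ).det := by rwa [Matrix.det_transpose]
    rw [Matrix.transpose_mul, Matrix.transpose_nonsing_inv]
    calc (X t)ᵀ⁻¹ * (Y t)ᵀ = (X t)ᵀ⁻¹ * ((Y t)ᵀ * X t) * (X t)⁻¹ := by
          rw [Matrix.mul_assoc, Matrix.mul_assoc (Y t)ᵀ, Matrix.mul_nonsing_inv _ hd, Matrix.mul_one]
      _ = (X t)ᵀ⁻¹ * ((X t)ᵀ * Y t) * (X t)⁻¹ := by rw [hsymm t ht]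
      _ = Y t * (X t)⁻¹ := by rw [Matrix.nonsing_inv_mul_cancel_left _ _ hd']
  · have hd := (Matrix.isUnit_iff_isUnit_det _).1 (hinj t ht)
    refine ((hY t ht).mul ((hX t ht).matrix_inv (hinj t ht))).congr_deriv ?_
    have e := Matrix.mul_nonsing_inv _ hd
    simp only [Matrix.sub_mul, Matrix.mul_sub, Matrix.neg_mul, Matrix.mul_neg, Matrix.mul_assoc, e,
      Matrix.mul_one]
    abel

/-! ### Uniqueness. -/

/-- The Riccati equation of a difference factors as `Ḋ = -(F - G S)ᵀ D - D (F - G S')`, so moving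
the left vector with `S` and the right one with `S'` cancels it. Only `S` has to be symmetric, hence
uniqueness holds among all matrix solutions. -/
theorem riccati_difference_identity {n : ℕ} {F G P S S' : Matrix (Fin n) (Fin n) ℝ}
    (hG : Gᵀ = G) (hS : Sᵀ = S) (x y : Fin n → ℝ) :
    ((F - G * S) *ᵥ x) ⬝ᵥ ((S' - S) *ᵥ y) + x ⬝ᵥ
      ((S' * G * S' - S' * F - Fᵀ * S' - P - (S * G * S - S * F - Fᵀ * S - P)) *ᵥ y +
        (S' - S) *ᵥ ((F - G * S') *ᵥ y)) = 0 := by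
  have e : (Fᵀ - S * G) * (S' - S) +
      ((S' * G * S' - S' * F - Fᵀ * S' - P - (S * G * S - S * F - Fᵀ * S - P)) +
        (S' - S) * (F - G * S')) = 0 := by
    noncomm_ring
  rw [dotProduct_comm, ← dotProduct_mulVec_transpose, ← dotProduct_add, Matrix.transpose_sub,
    Matrix.transpose_mul, hG, hS]
  simp only [Matrix.mulVec_mulVec, ← Matrix.add_mulVec]
  rw [e, Matrix.zero_mulVec, dotProduct_zero]

theorem riccati_solution_unique {n : ℕ} {T : ℝ}
    {F G P S S' : ℝ → Matrix (Fin n) (Fin n) ℝ} (hF : ContinuousOn F (Icc 0 T))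
    (hG : ContinuousOn G (Icc 0 T)) (hGs : ∀ t ∈ Icc 0 T, (G t)ᵀ = G t)
    (hSc : ContinuousOn S (Icc 0 T)) (hSc' : ContinuousOn S' (Icc 0 T))
    (hSs : ∀ t ∈ Icc 0 T, (S t)ᵀ = S t)
    (hS : ∀ t ∈ Ico 0 T, HasDerivWithinAt S
        (S t * G t * S t - S t * F t - (F t)ᵀ * S t - P t) (Icc 0 T) t)
    (hS' : ∀ t ∈ Ico 0 T, HasDerivWithinAt S'
        (S' t * G t * S' t - S' t * F t - (F t)ᵀ * S' t - P t) (Icc 0 T) t)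
    (h : S' T = S T) : EqOn S' S (Icc 0 T) := by
  intro t ht
  have hsub : Icc t T ⊆ Icc 0 T := Icc_subset_Icc ht.1 le_rfl
  have hA : ContinuousOn (fun r => F r - G r * S r) (Icc 0 T) := by fun_prop
  have hA' : ContinuousOn (fun r => F r - G r * S' r) (Icc 0 T) := by fun_prop
  refine matrix_ext_of_dotProduct_mulVec fun a b => ?_
  have ha := fun r hr => evolutionOperator_trajectory hA ht (t := r) hr a
  have hb := fun r hr => evolutionOperator_trajectory hA' ht (t := r) hr b
  set x := fun r => evolutionOperator (fun r => F r - G r * S r) r t *ᵥ a with hx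
  set y := fun r => evolutionOperator (fun r => F r - G r * S' r) r t *ᵥ b with hy
  have hxc : ContinuousOn x (Icc 0 T) := fun r hr => (ha r hr).continuousWithinAt
  have hyc : ContinuousOn y (Icc 0 T) := fun r hr => (hb r hr).continuousWithinAt
  have hc : ContinuousOn (fun r => x r ⬝ᵥ (S' r - S r) *ᵥ y r) (Icc t T) := by
    refine ContinuousOn.mono ?_ hsub
    rw [continuousOn_iff_continuous_domRestrict] at *
    exact hxc.dotProduct ((hSc'.sub hSc).matrix_mulVec hyc)
  have key := eq_of_hasDerivWithinAt_zero ht.1 ht.2 le_rfl hc fun r hr => by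
    have hr1 : r ∈ Icc 0 T := hsub (Ioo_subset_Icc_self hr)
    have hr2 : r ∈ Ico 0 T := ⟨hr1.1, hr.2⟩
    refine ((ha r hr1).dotProduct (((hS' r hr2).sub (hS r hr2)).matrix_mulVec
      (hb r hr1))).congr_deriv ?_
    exact riccati_difference_identity (hGs r hr1) (hSs r hr1) (x r) (y r)
  have hxt : x t = a := by simp [hx, evolutionOperator_self]
  have hyt : y t = b := by simp [hy, evolutionOperator_self]
  rw [h, sub_self, Matrix.zero_mulVec, dotProduct_zero, hxt, hyt, Matrix.sub_mulVec,
    dotProduct_sub] at key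
  exact sub_eq_zero.1 key

/-! ### Energy identity and bounds on the solution. -/

theorem riccati_form_hasDerivWithinAt {n : ℕ} {T t : ℝ}
    {F G P S : ℝ → Matrix (Fin n) (Fin n) ℝ} {x : ℝ → Fin n → ℝ} {v : Fin n → ℝ}
    (hSs : (S t)ᵀ = S t)
    (hS : HasDerivWithinAt S (S t * G t * S t - S t * F t - (F t)ᵀ * S t - P t) (Icc 0 T) t)
    (hx : HasDerivWithinAt x (F t *ᵥ x t + v) (Icc 0 T) t) :
    HasDerivWithinAt (fun r => x r ⬝ᵥ S r *ᵥ x r)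
      ((S t *ᵥ x t) ⬝ᵥ G t *ᵥ (S t *ᵥ x t) + 2 * ((S t *ᵥ x t) ⬝ᵥ v) - x t ⬝ᵥ P t *ᵥ x t)
      (Icc 0 T) t := by
  refine (hx.dotProduct (hS.matrix_mulVec hx)).congr_deriv ?_
  simp only [Matrix.sub_mulVec, ← Matrix.mulVec_mulVec, Matrix.mulVec_add, dotProduct_add,
    dotProduct_sub, add_dotProduct]
  rw [dotProduct_mulVec_transpose, dotProduct_comm v, dotProduct_comm (F t *ᵥ x t),
    dotProduct_mulVec_comm hSs v (x t), dotProduct_mulVec_comm hSs (F t *ᵥ x t) (x t),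
    dotProduct_mulVec_comm hSs (G t *ᵥ _) (x t), dotProduct_comm v,
    dotProduct_comm (F t *ᵥ x t), dotProduct_comm (G t *ᵥ _)]
  ring

/-- Along the optimal closed loop the form loses `q · G q + x · P x`, with `q = S x`, per unit time
and ends nonnegative. -/
theorem riccati_solution_nonneg {n : ℕ} {T : ℝ} {F G P S : ℝ → Matrix (Fin n) (Fin n) ℝ}
    (hF : ContinuousOn F (Icc 0 T)) (hG : ContinuousOn G (Icc 0 T))
    (hSs : ∀ t ∈ Icc 0 T, (S t)ᵀ = S t)
    (hS : ∀ t ∈ Icc 0 T, HasDerivWithinAt S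
        (S t * G t * S t - S t * F t - (F t)ᵀ * S t - P t) (Icc 0 T) t)
    (hG0 : ∀ t ∈ Icc 0 T, ∀ x, 0 ≤ x ⬝ᵥ G t *ᵥ x) (hP0 : ∀ t ∈ Icc 0 T, ∀ x, 0 ≤ x ⬝ᵥ P t *ᵥ x)
    (hST : ∀ x, 0 ≤ x ⬝ᵥ S T *ᵥ x) {t : ℝ} (ht : t ∈ Icc 0 T) (ξ : Fin n → ℝ) :
    0 ≤ ξ ⬝ᵥ S t *ᵥ ξ := by
  have hsub : Icc t T ⊆ Icc 0 T := Icc_subset_Icc ht.1 le_rfl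
  have hSc : ContinuousOn S (Icc 0 T) := fun r hr => (hS r hr).continuousWithinAt
  have hA : ContinuousOn (fun r => F r - G r * S r) (Icc 0 T) := by fun_prop
  have hx := fun r hr => evolutionOperator_trajectory hA ht (t := r) hr ξ
  set x := fun r => evolutionOperator (fun r => F r - G r * S r) r t *ᵥ ξ with hxd
  have hx' : ∀ r ∈ Icc 0 T, HasDerivWithinAt x (F r *ᵥ x r + -(G r *ᵥ (S r *ᵥ x r)))
      (Icc 0 T) r := fun r hr => (hx r hr).congr_deriv (by
    rw [Matrix.sub_mulVec, ← Matrix.mulVec_mulVec, sub_eq_add_neg])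
  have hd := fun r hr => riccati_form_hasDerivWithinAt (hSs r hr) (hS r hr) (hx' r hr)
  have h := le_of_hasDerivWithinAt_nonneg ht.1 ht.2 le_rfl
    (fun r hr => (hd r (hsub hr)).neg.continuousWithinAt.mono hsub)
    (fun r hr => (hd r (hsub (Ioo_subset_Icc_self hr))).neg) fun r hr => ?_
  · have hxt : x t = ξ := by simp [hxd, evolutionOperator_self]
    simp only [Pi.neg_apply, hxt] at h
    have := hST (x T)
    linarith
  · have hr' := hsub (Ioo_subset_Icc_self hr)
    have h1 := hG0 r hr' (S r *ᵥ x r)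
    have h2 := hP0 r hr' (x r)
    rw [dotProduct_neg]
    linarith

theorem two_mul_dotProduct_le {ι : Type*} [Fintype ι] {c : ℝ} (hc : 0 < c) (x y : ι → ℝ) :
    2 * (x ⬝ᵥ y) ≤ c * (x ⬝ᵥ x) + 1 / c * (y ⬝ᵥ y) := by
  have h := dotProduct_self_nonneg' (c • x - y)
  simp only [dotProduct_sub, sub_dotProduct, smul_dotProduct, dotProduct_smul, smul_eq_mul,
    dotProduct_comm y x] at h
  have h2 : 0 ≤ 1 / c * (c * (c * (x ⬝ᵥ x)) - c * (x ⬝ᵥ y) - (c * (x ⬝ᵥ y) - y ⬝ᵥ y)) :=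
    mul_nonneg (by positivity) (by linarith)
  have e : 1 / c * (c * (c * (x ⬝ᵥ x)) - c * (x ⬝ᵥ y) - (c * (x ⬝ᵥ y) - y ⬝ᵥ y)) =
    c * (x ⬝ᵥ x) - 2 * (x ⬝ᵥ y) + 1 / c * (y ⬝ᵥ y) := by field_simp; ring
  linarith

/-- The dual cost of steering `ż = -Fᵀ z + w` along `z = (1 - k (r - t)) ψ`, with `ψ̇ = -Fᵀ ψ`,
bounds `2 ξ · x - x · S(t) x` from above. -/
theorem riccati_dual_estimate {n : ℕ} {T μ g γ k t b : ℝ}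
    {F G P S : ℝ → Matrix (Fin n) (Fin n) ℝ}
    (hF : ContinuousOn F (Icc 0 T)) (hG : ContinuousOn G (Icc 0 T))
    (hGs : ∀ t ∈ Icc 0 T, (G t)ᵀ = G t) (hSs : ∀ t ∈ Icc 0 T, (S t)ᵀ = S t)
    (hS : ∀ t ∈ Icc 0 T, HasDerivWithinAt S
        (S t * G t * S t - S t * F t - (F t)ᵀ * S t - P t) (Icc 0 T) t)
    (hμ : 0 < μ) (hFμ : ∀ t ∈ Icc 0 T, ∀ x, |x ⬝ᵥ F t *ᵥ x| ≤ μ * (x ⬝ᵥ x))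
    (hG0 : ∀ t ∈ Icc 0 T, ∀ x, 0 ≤ x ⬝ᵥ G t *ᵥ x) (hg : 0 ≤ g)
    (hGg : ∀ t ∈ Icc 0 T, ∀ x, x ⬝ᵥ G t *ᵥ x ≤ g * (x ⬝ᵥ x)) (hγ : 0 < γ)
    (hP : ∀ t ∈ Icc 0 T, ∀ x, γ * (x ⬝ᵥ x) ≤ x ⬝ᵥ P t *ᵥ x)
    (ht : 0 ≤ t) (htb : t ≤ b) (hb : b ≤ T) (hk : 0 ≤ k) (hkb : k * (b - t) ≤ 1)
    (ξ x₀ : Fin n → ℝ) :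
    ∃ z x : Fin n → ℝ,
      z ⬝ᵥ z ≤ (1 - k * (b - t)) ^ 2 * (Real.exp (2 * μ * (b - t)) * (ξ ⬝ᵥ ξ)) ∧
      2 * (ξ ⬝ᵥ x₀) - x₀ ⬝ᵥ S t *ᵥ x₀ ≤ 2 * (z ⬝ᵥ x) - x ⬝ᵥ S b *ᵥ x +
        (g + k ^ 2 / γ) * (ξ ⬝ᵥ ξ) * ((Real.exp (2 * μ * (b - t)) - 1) / (2 * μ)) := by
  have ht' : t ∈ Icc 0 T := ⟨ht, htb.trans hb⟩
  have hsub : Icc t b ⊆ Icc 0 T := Icc_subset_Icc ht hb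
  have hSc : ContinuousOn S (Icc 0 T) := fun r hr => (hS r hr).continuousWithinAt
  have hA : ContinuousOn (fun r => F r - G r * S r) (Icc 0 T) := by fun_prop
  have hD : ContinuousOn (fun r => -(F r)ᵀ) (Icc 0 T) := by fun_prop
  have hDμ : ∀ t ∈ Icc 0 T, ∀ x, |x ⬝ᵥ (-(F t)ᵀ) *ᵥ x| ≤ μ * (x ⬝ᵥ x) := fun t ht x => by
    rw [Matrix.neg_mulVec, dotProduct_neg, abs_neg, dotProduct_mulVec_transpose]
    exact hFμ t ht x
  have hx := fun r hr => evolutionOperator_trajectory hA ht' (t := r) hr x₀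
  set x := fun r => evolutionOperator (fun r => F r - G r * S r) r t *ᵥ x₀ with hxd
  have hx' : ∀ r ∈ Icc 0 T, HasDerivWithinAt x (F r *ᵥ x r + -(G r *ᵥ (S r *ᵥ x r)))
      (Icc 0 T) r := fun r hr => (hx r hr).congr_deriv (by
    rw [Matrix.sub_mulVec, ← Matrix.mulVec_mulVec, sub_eq_add_neg])
  have hψ := fun r hr => evolutionOperator_trajectory hD ht' (t := r) hr ξ
  have hψn := fun r hr hr' => (evolutionOperator_mulVec_sq_le hD hDμ ht' (t := r) hr hr' ξ).1
  set ψ := fun r => evolutionOperator (fun r => -(F r)ᵀ) r t *ᵥ ξ with hψd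
  have hφ : ∀ r, HasDerivWithinAt (fun r => 1 - k * (r - t)) (-k) (Icc 0 T) r := fun r => by
    simpa using (((hasDerivWithinAt_id r (Icc 0 T)).sub_const t).const_mul k).const_sub 1
  have hz : ∀ r ∈ Icc 0 T, HasDerivWithinAt (fun r => (1 - k * (r - t)) • ψ r) _ (Icc 0 T) r :=
    fun r hr => (hφ r).smul (hψ r hr)
  -- The quantity `2 z · x - x · S x` plus the accumulated dual cost is to be monotone. Its
  -- derivative is `(q - z) · G (q - z) - z · G z + x · P x - 2 k ψ · x` plus the dual cost rate,
  -- where `q = S x`. The term `z · G z` is paid by `g`, and `2 k ψ · x` by the coercivity of `P` at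
  -- price `k ^ 2 / γ`.
  have hd := fun r hr => ((((hz r hr).dotProduct (hx r hr)).const_mul 2).sub
    (riccati_form_hasDerivWithinAt (hSs r hr) (hS r hr) (hx' r hr))).add
    ((hasDerivWithinAt_exp_div (s := Icc 0 T) (t := r) (a := t) (c := 2 * μ)
      (by positivity)).const_mul ((g + k ^ 2 / γ) * (ξ ⬝ᵥ ξ)))
  have h := le_of_hasDerivWithinAt_nonneg ht htb hb
    (fun r hr => (hd r (hsub hr)).continuousWithinAt.mono hsub)
    (fun r hr => hd r (hsub (Ioo_subset_Icc_self hr))) fun r hr => ?_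
  · have hxt : x t = x₀ := by simp [hxd, evolutionOperator_self]
    have hψt : ψ t = ξ := by simp [hψd, evolutionOperator_self]
    refine ⟨(1 - k * (b - t)) • ψ b, x b, ?_, ?_⟩
    · rw [smul_dotProduct, dotProduct_smul, smul_eq_mul, smul_eq_mul, ← mul_assoc, ← sq]
      gcongr
      exact hψn b ⟨ht.trans htb, hb⟩ htb
    · simpa [hxt, hψt] using h
  · have hr' := hsub (Ioo_subset_Icc_self hr)
    have hn := hψn r hr' hr.1.le
    have hφ0 : 0 ≤ 1 - k * (r - t) := by nlinarith [hr.2]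
    have hφ1 : 1 - k * (r - t) ≤ 1 := by nlinarith [hr.1]
    set φ := 1 - k * (r - t)
    set E := Real.exp (2 * μ * (r - t))
    set q := S r *ᵥ x r with hq
    have h1 := hP r hr' (x r)
    have h2 := hG0 r hr' (q - φ • ψ r)
    have h3 := hGg r hr' (ψ r)
    have h4 := two_mul_dotProduct_le hγ (x r) (k • ψ r)
    have e := dotProduct_mulVec_comm (hGs r hr') (ψ r) q
    have hψ0 := dotProduct_self_nonneg' (ψ r)
    have h5 : φ ^ 2 * (ψ r ⬝ᵥ G r *ᵥ ψ r) ≤ g * (E * (ξ ⬝ᵥ ξ)) :=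
      calc φ ^ 2 * (ψ r ⬝ᵥ G r *ᵥ ψ r) ≤ 1 * (ψ r ⬝ᵥ G r *ᵥ ψ r) := by
            gcongr
            · exact hG0 r hr' _
            · exact pow_le_one₀ hφ0 hφ1
        _ ≤ g * (ψ r ⬝ᵥ ψ r) := by rwa [one_mul]
        _ ≤ g * (E * (ξ ⬝ᵥ ξ)) := by gcongr
    have h6 : k ^ 2 / γ * (ψ r ⬝ᵥ ψ r) ≤ k ^ 2 / γ * (E * (ξ ⬝ᵥ ξ)) := by gcongr
    have e2 : (F r - G r * S r) *ᵥ x r = F r *ᵥ x r - G r *ᵥ q := by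
      rw [Matrix.sub_mulVec, ← Matrix.mulVec_mulVec]
    change 0 ≤ 2 * ((φ • ((-(F r)ᵀ) *ᵥ ψ r) + (-k) • ψ r) ⬝ᵥ x r +
      (φ • ψ r) ⬝ᵥ ((F r - G r * S r) *ᵥ x r)) - (q ⬝ᵥ G r *ᵥ q + 2 * (q ⬝ᵥ -(G r *ᵥ q)) -
        x r ⬝ᵥ P r *ᵥ x r) + (g + k ^ 2 / γ) * (ξ ⬝ᵥ ξ) * E
    rw [e2]
    have e3 : ((F r)ᵀ *ᵥ ψ r) ⬝ᵥ x r = ψ r ⬝ᵥ F r *ᵥ x r := by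
      rw [dotProduct_comm, dotProduct_mulVec_transpose]
    simp only [Matrix.mulVec_sub, Matrix.mulVec_smul, dotProduct_sub, sub_dotProduct,
      smul_dotProduct, dotProduct_smul, smul_eq_mul, Matrix.neg_mulVec, neg_dotProduct,
      add_dotProduct, dotProduct_neg, e, e3, dotProduct_comm (x r) (ψ r)] at h2 h4 ⊢
    have e4 : 1 / γ * (k * (k * (ψ r ⬝ᵥ ψ r))) = k ^ 2 / γ * (ψ r ⬝ᵥ ψ r) := by ring
    nlinarith

/-- A quadratic form whose conjugate is bounded by `C` is bounded below by `1 / C`. -/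
theorem le_form_of_conjugate_le {n : ℕ} {S : Matrix (Fin n) (Fin n) ℝ} {C : ℝ} (hC : 0 < C)
    {x : Fin n → ℝ} (h : ∀ ξ : Fin n → ℝ, 2 * (ξ ⬝ᵥ x) - x ⬝ᵥ S *ᵥ x ≤ C * (ξ ⬝ᵥ ξ)) :
    C⁻¹ * (x ⬝ᵥ x) ≤ x ⬝ᵥ S *ᵥ x := by
  -- This choice maximises `2 ξ · x - C |ξ|²`.
  have := h (C⁻¹ • x)
  simp only [smul_dotProduct, dotProduct_smul, smul_eq_mul] at this
  rw [mul_inv_cancel_left₀ hC.ne'] at this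
  linarith

/-- The zero control costs the integral of `x · P x` plus the terminal cost, and the state grows at
most at rate `μ`. -/
theorem riccati_le_of_free_motion {n : ℕ} {T μ q t : ℝ}
    {F G P S : ℝ → Matrix (Fin n) (Fin n) ℝ} (hF : ContinuousOn F (Icc 0 T))
    (hSs : ∀ t ∈ Icc 0 T, (S t)ᵀ = S t)
    (hS : ∀ t ∈ Icc 0 T, HasDerivWithinAt S
        (S t * G t * S t - S t * F t - (F t)ᵀ * S t - P t) (Icc 0 T) t)
    (hμ : 0 < μ) (hFμ : ∀ t ∈ Icc 0 T, ∀ x, |x ⬝ᵥ F t *ᵥ x| ≤ μ * (x ⬝ᵥ x))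
    (hG0 : ∀ t ∈ Icc 0 T, ∀ x, 0 ≤ x ⬝ᵥ G t *ᵥ x) (hq : 0 ≤ q)
    (hP : ∀ t ∈ Icc 0 T, ∀ x, x ⬝ᵥ P t *ᵥ x ≤ q * (x ⬝ᵥ x))
    (hST : ∀ x, x ⬝ᵥ S T *ᵥ x ≤ q * (x ⬝ᵥ x)) (ht : t ∈ Icc 0 T) (ξ : Fin n → ℝ) :
    ξ ⬝ᵥ S t *ᵥ ξ ≤ q * (1 + 1 / (2 * μ)) * Real.exp (2 * μ * (T - t)) * (ξ ⬝ᵥ ξ) := by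
  have hTm : T ∈ Icc 0 T := ⟨ht.1.trans ht.2, le_rfl⟩
  have hsub : Icc t T ⊆ Icc 0 T := Icc_subset_Icc ht.1 le_rfl
  have hx := fun r hr => evolutionOperator_trajectory hF ht (t := r) hr ξ
  have hxn := fun r hr hr' => (evolutionOperator_mulVec_sq_le hF hFμ ht (t := r) hr hr' ξ).1
  set x := fun r => evolutionOperator F r t *ᵥ ξ with hxd
  have hx' : ∀ r ∈ Icc 0 T, HasDerivWithinAt x (F r *ᵥ x r + 0) (Icc 0 T) r := fun r hr =>
    (hx r hr).congr_deriv (by rw [add_zero])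
  have hd := fun r hr =>
    (riccati_form_hasDerivWithinAt (hSs r hr) (hS r hr) (hx' r hr)).add
    ((hasDerivWithinAt_exp_div (s := Icc 0 T) (t := r) (a := t) (c := 2 * μ)
      (by positivity)).const_mul (q * (ξ ⬝ᵥ ξ)))
  have h := le_of_hasDerivWithinAt_nonneg ht.1 ht.2 le_rfl
    (fun r hr => (hd r (hsub hr)).continuousWithinAt.mono hsub)
    (fun r hr => hd r (hsub (Ioo_subset_Icc_self hr))) fun r hr => ?_
  · have hxt : x t = ξ := by simp [hxd, evolutionOperator_self]
    have h2 := hST (x T)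
    have h3 : q * (x T ⬝ᵥ x T) ≤ q * (Real.exp (2 * μ * (T - t)) * (ξ ⬝ᵥ ξ)) := by
      gcongr
      exact hxn T hTm ht.2
    have h4 : 0 ≤ q * (ξ ⬝ᵥ ξ) * (1 / (2 * μ)) :=
      mul_nonneg (mul_nonneg hq (dotProduct_self_nonneg' ξ)) (by positivity)
    simp only [Pi.add_apply, hxt, sub_self, mul_zero, Real.exp_zero, zero_div, add_zero] at h
    have e : q * (ξ ⬝ᵥ ξ) * ((Real.exp (2 * μ * (T - t)) - 1) / (2 * μ)) =
      q * (ξ ⬝ᵥ ξ) * (1 / (2 * μ)) * Real.exp (2 * μ * (T - t)) -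
        q * (ξ ⬝ᵥ ξ) * (1 / (2 * μ)) := by ring
    linarith
  · have hr' := hsub (Ioo_subset_Icc_self hr)
    have h1 := hG0 r hr' (S r *ᵥ x r)
    have h2 := hP r hr' (x r)
    have h3 : q * (x r ⬝ᵥ x r) ≤ q * (Real.exp (2 * μ * (r - t)) * (ξ ⬝ᵥ ξ)) := by
      gcongr
      exact hxn r hr' hr.1.le
    rw [dotProduct_zero]
    linarith

theorem sub_dotProduct_self_le {ι : Type*} [Fintype ι] {a b N : ℝ} (ha : 0 ≤ a) (hb : 0 ≤ b)
    (hN : 0 ≤ N) {p q : ι → ℝ} (hp : p ⬝ᵥ p ≤ a ^ 2 * N) (hq : q ⬝ᵥ q ≤ b ^ 2 * N) :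
    (p - q) ⬝ᵥ (p - q) ≤ (a + b) ^ 2 * N := by
  have h := dotProduct_le_of_sq_le (x := -p) (y := q) (a := a * √N) (b := b * √N)
    (by positivity) (by positivity)
    (by rw [mul_pow, Real.sq_sqrt hN, neg_dotProduct_neg]; exact hp)
    (by rw [mul_pow, Real.sq_sqrt hN]; exact hq)
  have e : a * √N * (b * √N) = a * b * N := by
    rw [mul_mul_mul_comm, Real.mul_self_sqrt hN]
  rw [e, neg_dotProduct] at h
  simp only [dotProduct_sub, sub_dotProduct, dotProduct_comm q p]
  linarith

theorem add_dotProduct_self_le {ι : Type*} [Fintype ι] (p q : ι → ℝ) :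
    (p + q) ⬝ᵥ (p + q) ≤ 2 * (p ⬝ᵥ p) + 2 * (q ⬝ᵥ q) := by
  have := dotProduct_self_nonneg' (p - q)
  simp only [dotProduct_sub, sub_dotProduct, dotProduct_add, add_dotProduct] at *
  linarith

/-- The minimum energy state is bounded by `1 + c / α` times its initial value. -/
theorem gramian_residual_sq_le {k l : ℕ} {T s t c α : ℝ} {A : ℝ → Matrix (Fin k) (Fin k) ℝ}
    {B : ℝ → Matrix (Fin k) (Fin l) ℝ} (hA : ContinuousOn A (Icc 0 T))
    (hB : ContinuousOn B (Icc 0 T)) (hs : 0 ≤ s) (hst : s ≤ t) (ht : t ≤ T) (hc : 0 < c)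
    (hα : 0 < α) (hW : ∀ x, x ⬝ᵥ gramian A B s t *ᵥ x ≤ c * (x ⬝ᵥ x)) {ξ y : Fin k → ℝ}
    (hy : y ⬝ᵥ y ≤ (1 / α) ^ 2 * (ξ ⬝ᵥ ξ)) :
    (ξ - gramian A B s t *ᵥ y) ⬝ᵥ (ξ - gramian A B s t *ᵥ y) ≤ (1 + c / α) ^ 2 * (ξ ⬝ᵥ ξ) := by
  refine sub_dotProduct_self_le zero_le_one (by positivity) (dotProduct_self_nonneg' ξ)
    (by simp) ?_
  calc _ ≤ c ^ 2 * (y ⬝ᵥ y) := mulVec_sq_le_of_le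
        (gramian_transpose hA hB ⟨hs, hst.trans ht⟩ ⟨hs.trans hst, ht⟩ hst) hc
        (gramian_form_nonneg hA hB hs hst ht) hW y
    _ ≤ c ^ 2 * ((1 / α) ^ 2 * (ξ ⬝ᵥ ξ)) := by gcongr
    _ = (c / α) ^ 2 * (ξ ⬝ᵥ ξ) := by ring

/-- Cost of the control that steers `(A, B)` to the origin with minimum energy on `[t, b]`, for
dynamics written with a feedback `F = A - B K`. -/
theorem riccati_le_of_minimum_energy {n m : ℕ} {T lam q ρ h c₀ c₁ α t b : ℝ}
    {A F G P S : ℝ → Matrix (Fin n) (Fin n) ℝ} {B : ℝ → Matrix (Fin n) (Fin m) ℝ}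
    {K : ℝ → Matrix (Fin m) (Fin n) ℝ} {R : ℝ → Matrix (Fin m) (Fin m) ℝ}
    (hA : ContinuousOn A (Icc 0 T)) (hB : ContinuousOn B (Icc 0 T))
    (hFA : ∀ t ∈ Icc 0 T, F t = A t - B t * K t)
    (hSs : ∀ t ∈ Icc 0 T, (S t)ᵀ = S t)
    (hS : ∀ t ∈ Icc 0 T, HasDerivWithinAt S
        (S t * G t * S t - S t * F t - (F t)ᵀ * S t - P t) (Icc 0 T) t)
    (hlam : 0 < lam) (hAl : ∀ t ∈ Icc 0 T, ∀ x, |x ⬝ᵥ A t *ᵥ x| ≤ lam * (x ⬝ᵥ x))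
    (hGR : ∀ t ∈ Icc 0 T, ∀ p v, -(v ⬝ᵥ R t *ᵥ v) ≤ p ⬝ᵥ G t *ᵥ p + 2 * (p ⬝ᵥ B t *ᵥ v))
    (hq : 0 ≤ q) (hP : ∀ t ∈ Icc 0 T, ∀ x, x ⬝ᵥ P t *ᵥ x ≤ q * (x ⬝ᵥ x))
    (hρ : 0 ≤ ρ) (hR : ∀ t ∈ Icc 0 T, ∀ v, v ⬝ᵥ R t *ᵥ v ≤ ρ * (v ⬝ᵥ v))
    (hK : ∀ t ∈ Icc 0 T, ∀ x, (K t *ᵥ x) ⬝ᵥ (K t *ᵥ x) ≤ h ^ 2 * (x ⬝ᵥ x))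
    (hα : 0 < α) (hc₀ : 0 < c₀) (hc₁ : 0 < c₁)
    (hW : ∀ x, α * (x ⬝ᵥ x) ≤ x ⬝ᵥ gramian A B t b *ᵥ x)
    (hW₀ : ∀ x, x ⬝ᵥ gramian A B t b *ᵥ x ≤ c₀ * (x ⬝ᵥ x))
    (hW₁ : ∀ x, x ⬝ᵥ gramian A B t b *ᵥ x ≤ c₁ * (x ⬝ᵥ x))
    (ht : 0 ≤ t) (htb : t ≤ b) (hb : b ≤ T) (ξ : Fin n → ℝ) :
    ξ ⬝ᵥ S t *ᵥ ξ ≤ (q * (1 + c₀ / α) ^ 2 * ((Real.exp (2 * lam * (b - t)) - 1) / (2 * lam)) +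
      ρ * (2 / α + 2 * h ^ 2 * (1 + c₁ / α) ^ 2 *
        ((Real.exp (2 * lam * (b - t)) - 1) / (2 * lam)))) * (ξ ⬝ᵥ ξ) := by
  have ht' : t ∈ Icc 0 T := ⟨ht, htb.trans hb⟩
  have hsub : Icc t b ⊆ Icc 0 T := Icc_subset_Icc ht hb
  set y := (gramian A B t b)⁻¹ *ᵥ ξ with hyd
  have hWy : gramian A B t b *ᵥ y = ξ := mulVec_inv_mulVec (isUnit_of_coercive hα hW) ξ
  have hy : y ⬝ᵥ y ≤ (1 / α) ^ 2 * (ξ ⬝ᵥ ξ) := inv_mulVec_sq_le hα hW ξ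
  have hyξ : y ⬝ᵥ ξ ≤ 1 / α * (ξ ⬝ᵥ ξ) := by
    rw [dotProduct_comm]
    exact dotProduct_inv_mulVec_le hα hW ξ
  -- Variation of constants for the minimum energy control `u`, with `y = W⁻¹ ξ`, so that `x b = 0`.
  -- Adding `K x` in `v` undoes the feedback: `F x + B v = A x + B u`.
  let x : ℝ → Fin n → ℝ := fun r => evolutionOperator A r t *ᵥ (ξ - gramian A B t r *ᵥ y)
  let u : ℝ → Fin m → ℝ := fun r => -((B r)ᵀ *ᵥ ((evolutionOperator A t r)ᵀ *ᵥ y))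
  let v : ℝ → Fin m → ℝ := fun r => u r + K r *ᵥ x r
  have hx : ∀ r ∈ Icc 0 T, HasDerivWithinAt x (F r *ᵥ x r + B r *ᵥ v r) (Icc 0 T) r := by
    intro r hr
    refine ((evolutionOperator_hasDerivWithinAt hA ht' hr).matrix_mulVec
      (((gramian_hasDerivWithinAt hA hB ht' hr).matrix_mulVec_const y).const_sub ξ)).congr_deriv ?_
    simp only [x, u, v]
    rw [hFA r hr, Matrix.mulVec_neg, Matrix.mulVec_mulVec _ (evolutionOperator A r t)]
    simp only [← Matrix.mul_assoc]
    rw [evolutionOperator_mul_symm hA ht' hr]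
    simp only [Matrix.one_mul, Matrix.sub_mulVec, Matrix.mulVec_add, Matrix.mulVec_neg,
      ← Matrix.mulVec_mulVec]
    abel
  -- The last summand accumulates the energy of `u`, whose total is `y · W y = y · ξ ≤ |ξ|² / α`.
  -- The factors `2` come from `|u + K x|² ≤ 2 |u|² + 2 |K x|²`.
  have hd := fun r hr =>
    ((riccati_form_hasDerivWithinAt (hSs r hr) (hS r hr) (hx r hr)).add
    ((hasDerivWithinAt_exp_div (s := Icc 0 T) (t := r) (a := t) (c := 2 * lam)
      (by positivity)).const_mul (q * (1 + c₀ / α) ^ 2 * (ξ ⬝ᵥ ξ) +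
        ρ * (2 * h ^ 2 * (1 + c₁ / α) ^ 2 * (ξ ⬝ᵥ ξ))))).add
    ((gramian_form_hasDerivWithinAt hA hB ht' hr y y).const_mul (ρ * 2))
  have hmono := le_of_hasDerivWithinAt_nonneg ht htb hb
    (fun r hr => (hd r (hsub hr)).continuousWithinAt.mono hsub)
    (fun r hr => hd r (hsub (Ioo_subset_Icc_self hr))) fun r hr => ?_
  · have hxt : x t = ξ := by simp [x, evolutionOperator_self, gramian_self]
    have hxb : x b = 0 := by simp [x, hWy]
    simp only [Pi.add_apply, hxt, hxb, sub_self, mul_zero, Real.exp_zero, zero_div, add_zero,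
      gramian_self, Matrix.zero_mulVec, dotProduct_zero, hWy, zero_dotProduct, zero_add] at hmono
    have h1 : ρ * 2 * (y ⬝ᵥ ξ) ≤ ρ * 2 * (1 / α * (ξ ⬝ᵥ ξ)) := by gcongr
    have e : ρ * 2 * (1 / α * (ξ ⬝ᵥ ξ)) = ρ * (2 / α) * (ξ ⬝ᵥ ξ) := by ring
    linarith
  · have hr' := hsub (Ioo_subset_Icc_self hr)
    have hrb : r ≤ T := hr.2.le.trans hb
    set E := Real.exp (2 * lam * (r - t))
    have hE : 0 ≤ E := (Real.exp_pos _).le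
    -- Either upper bound of the Gramian may be used: `c₀` enters the state cost and `c₁` the cost
    -- of the feedback correction.
    have hxn : ∀ c, 0 < c → (∀ x, x ⬝ᵥ gramian A B t b *ᵥ x ≤ c * (x ⬝ᵥ x)) →
        x r ⬝ᵥ x r ≤ E * ((1 + c / α) ^ 2 * (ξ ⬝ᵥ ξ)) := fun c hc hWc =>
      (evolutionOperator_mulVec_sq_le hA hAl ht' hr' hr.1.le _).1.trans
        (mul_le_mul_of_nonneg_left (gramian_residual_sq_le hA hB ht hr.1.le hrb hc hα
          (fun z => (gramian_form_mono hA hB ht hr.1.le hr.2.le hb z).trans (hWc z)) hy) hE)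
    have h1 := hGR r hr' (S r *ᵥ x r) (v r)
    have h2 := hP r hr' (x r)
    have h3 := hR r hr' (v r)
    have h4 : q * (x r ⬝ᵥ x r) ≤ q * (E * ((1 + c₀ / α) ^ 2 * (ξ ⬝ᵥ ξ))) := by
      gcongr
      exact hxn c₀ hc₀ hW₀
    have h5 : v r ⬝ᵥ v r ≤ 2 * (u r ⬝ᵥ u r) + 2 * (h ^ 2 * (E * ((1 + c₁ / α) ^ 2 * (ξ ⬝ᵥ ξ)))) := by
      refine (add_dotProduct_self_le (u r) (K r *ᵥ x r)).trans ?_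
      gcongr
      refine (hK r hr' (x r)).trans ?_
      gcongr
      exact hxn c₁ hc₁ hW₁
    have h6 := mul_le_mul_of_nonneg_left h5 hρ
    have e : u r ⬝ᵥ u r = ((B r)ᵀ *ᵥ ((evolutionOperator A t r)ᵀ *ᵥ y)) ⬝ᵥ
        ((B r)ᵀ *ᵥ ((evolutionOperator A t r)ᵀ *ᵥ y)) := neg_dotProduct_neg _ _
    rw [← e]
    linarith

/-! ### Bounds on the closed-loop coefficients. -/

theorem dotProduct_conj_mulVec {k l : ℕ} (M : Matrix (Fin l) (Fin k) ℝ)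
    (N : Matrix (Fin l) (Fin l) ℝ) (x : Fin k → ℝ) :
    x ⬝ᵥ (Mᵀ * N * M) *ᵥ x = (M *ᵥ x) ⬝ᵥ N *ᵥ (M *ᵥ x) := by
  rw [← Matrix.mulVec_mulVec, ← Matrix.mulVec_mulVec, dotProduct_mulVec_transpose,
    dotProduct_comm]

theorem mul_mulVec_sq_le {k l p : ℕ} {M : Matrix (Fin k) (Fin l) ℝ} {N : Matrix (Fin l) (Fin p) ℝ}
    {c d : ℝ} (hM : ∀ x, (M *ᵥ x) ⬝ᵥ (M *ᵥ x) ≤ c ^ 2 * (x ⬝ᵥ x))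
    (hN : ∀ x, (N *ᵥ x) ⬝ᵥ (N *ᵥ x) ≤ d ^ 2 * (x ⬝ᵥ x)) (x : Fin p → ℝ) :
    ((M * N) *ᵥ x) ⬝ᵥ ((M * N) *ᵥ x) ≤ (c * d) ^ 2 * (x ⬝ᵥ x) := by
  rw [← Matrix.mulVec_mulVec]
  calc _ ≤ c ^ 2 * ((N *ᵥ x) ⬝ᵥ (N *ᵥ x)) := hM _
    _ ≤ c ^ 2 * (d ^ 2 * (x ⬝ᵥ x)) := by gcongr; exact hN x
    _ = (c * d) ^ 2 * (x ⬝ᵥ x) := by ring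

section Coefficients

variable {n m : ℕ} {A : Matrix (Fin n) (Fin n) ℝ} {B : Matrix (Fin n) (Fin m) ℝ}
  {Q : Matrix (Fin n) (Fin n) ℝ} {H : Matrix (Fin m) (Fin n) ℝ} {R : Matrix (Fin m) (Fin m) ℝ}
  {lamA lamB lamQ lamH γR : ℝ}

theorem feedback_mulVec_sq_le (hγ : 0 < γR) (hH : ‖H‖ ≤ lamH)
    (hR : ∀ x, γR * (x ⬝ᵥ x) ≤ x ⬝ᵥ R *ᵥ x) (x : Fin n → ℝ) :
    ((R⁻¹ * H) *ᵥ x) ⬝ᵥ ((R⁻¹ * H) *ᵥ x) ≤ (lamH / γR) ^ 2 * (x ⬝ᵥ x) := by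
  have h := mul_mulVec_sq_le (inv_mulVec_sq_le hγ hR) (mulVec_sq_le hH) x
  rwa [one_div_mul_eq_div] at h

theorem closedLoop_form_le (hγ : 0 < γR) (hA : ‖A‖ ≤ lamA) (hB : ‖B‖ ≤ lamB) (hH : ‖H‖ ≤ lamH)
    (hR : ∀ x, γR * (x ⬝ᵥ x) ≤ x ⬝ᵥ R *ᵥ x) (x : Fin n → ℝ) :
    |x ⬝ᵥ (A - B * R⁻¹ * H) *ᵥ x| ≤ growthRate lamA lamB lamH γR * (x ⬝ᵥ x) := by
  have hA0 := (norm_nonneg _).trans hA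
  have hB0 := (norm_nonneg _).trans hB
  have hH0 := (norm_nonneg _).trans hH
  have h1 := abs_dotProduct_mulVec_self_le hA0 (mulVec_sq_le hA) x
  have h2 := abs_dotProduct_mulVec_self_le (M := B * (R⁻¹ * H)) (by positivity)
    (mul_mulVec_sq_le (mulVec_sq_le hB) (feedback_mulVec_sq_le hγ hH hR)) x
  rw [Matrix.mul_assoc, Matrix.sub_mulVec, dotProduct_sub, growthRate, add_mul, mul_div_assoc]
  exact (abs_sub _ _).trans (add_le_add h1 h2)

theorem inputWeight_form_nonneg (hγ : 0 < γR) (hR : ∀ x, γR * (x ⬝ᵥ x) ≤ x ⬝ᵥ R *ᵥ x)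
    (x : Fin n → ℝ) : 0 ≤ x ⬝ᵥ (B * R⁻¹ * Bᵀ) *ᵥ x := by
  have h := dotProduct_conj_mulVec Bᵀ R⁻¹ x
  rw [Matrix.transpose_transpose] at h
  rw [h]
  exact dotProduct_inv_mulVec_nonneg hγ hR _

theorem inputWeight_form_le (hγ : 0 < γR) (hB : ‖B‖ ≤ lamB)
    (hR : ∀ x, γR * (x ⬝ᵥ x) ≤ x ⬝ᵥ R *ᵥ x) (x : Fin n → ℝ) :
    x ⬝ᵥ (B * R⁻¹ * Bᵀ) *ᵥ x ≤ lamB ^ 2 / γR * (x ⬝ᵥ x) := by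
  have h := dotProduct_conj_mulVec Bᵀ R⁻¹ x
  rw [Matrix.transpose_transpose] at h
  rw [h]
  calc _ ≤ 1 / γR * ((Bᵀ *ᵥ x) ⬝ᵥ (Bᵀ *ᵥ x)) := dotProduct_inv_mulVec_le hγ hR _
    _ ≤ 1 / γR * (lamB ^ 2 * (x ⬝ᵥ x)) := by
      gcongr
      exact mulVec_sq_le (by rwa [norm_transpose_eq]) x
    _ = _ := by ring

theorem inputWeight_transpose (hRs : Rᵀ = R) : (B * R⁻¹ * Bᵀ)ᵀ = B * R⁻¹ * Bᵀ := by
  rw [Matrix.transpose_mul, Matrix.transpose_mul, Matrix.transpose_transpose,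
    Matrix.transpose_nonsing_inv, hRs, Matrix.mul_assoc]

/-- The difference of the two sides is the `R`-form of `v + R⁻¹ Bᵀ p`: completion of the square in
the control. -/
theorem neg_inputCost_le (hγ : 0 < γR) (hRs : Rᵀ = R) (hR : ∀ x, γR * (x ⬝ᵥ x) ≤ x ⬝ᵥ R *ᵥ x)
    (p : Fin n → ℝ) (v : Fin m → ℝ) :
    -(v ⬝ᵥ R *ᵥ v) ≤ p ⬝ᵥ (B * R⁻¹ * Bᵀ) *ᵥ p + 2 * (p ⬝ᵥ B *ᵥ v) := by
  have h := dotProduct_conj_mulVec Bᵀ R⁻¹ p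
  rw [Matrix.transpose_transpose] at h
  rw [h]
  have e : v ⬝ᵥ Bᵀ *ᵥ p = p ⬝ᵥ B *ᵥ v := dotProduct_mulVec_transpose B p v
  set w := Bᵀ *ᵥ p
  have h1 : 0 ≤ (v + R⁻¹ *ᵥ w) ⬝ᵥ R *ᵥ (v + R⁻¹ *ᵥ w) :=
    (mul_nonneg hγ.le (dotProduct_self_nonneg' _)).trans (hR _)
  rw [Matrix.mulVec_add, add_dotProduct, dotProduct_add, dotProduct_add,
    dotProduct_mulVec_comm hRs v (R⁻¹ *ᵥ w), mulVec_inv_mulVec (isUnit_of_coercive hγ hR)] at h1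
  have e2 := dotProduct_comm (R⁻¹ *ᵥ w) w
  linarith

/-- The subtracted term is nonnegative, so `lamQ` alone suffices where the stated constants allow
`lamQ + lamH ^ 2 / γR`. -/
theorem stateCost_form_le (hγ : 0 < γR) (hQ : ‖Q‖ ≤ lamQ)
    (hR : ∀ x, γR * (x ⬝ᵥ x) ≤ x ⬝ᵥ R *ᵥ x) (x : Fin n → ℝ) :
    x ⬝ᵥ (Q - Hᵀ * R⁻¹ * H) *ᵥ x ≤ lamQ * (x ⬝ᵥ x) := by
  have h1 := (le_abs_self _).trans (abs_dotProduct_mulVec_self_le ((norm_nonneg _).trans hQ)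
    (mulVec_sq_le hQ) x)
  have h2 := dotProduct_inv_mulVec_nonneg hγ hR (H *ᵥ x)
  rw [Matrix.sub_mulVec, dotProduct_sub, dotProduct_conj_mulVec]
  linarith

end Coefficients

/-! ### Comparison with the stated constants. -/

section Constants

/-- Convexity: `a s` is the combination of `0` and `b s` with weight `a / b` on `b s`. -/
theorem exp_sub_one_div_mono {a b s : ℝ} (ha : 0 < a) (hab : a ≤ b) :
    (Real.exp (a * s) - 1) / a ≤ (Real.exp (b * s) - 1) / b := by
  have hb := ha.trans_le hab
  have hc := convexOn_exp.2 (mem_univ (0 : ℝ)) (mem_univ (b * s))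
    (sub_nonneg.2 ((div_le_one hb).2 hab)) (by positivity : 0 ≤ a / b) (by ring)
  have e : a / b * (b * s) = a * s := by field_simp
  simp only [smul_eq_mul, mul_zero, zero_add, e, Real.exp_zero, mul_one] at hc
  rw [div_le_div_iff₀ ha hb]
  have h2 := mul_le_mul_of_nonneg_right hc hb.le
  have e2 : (1 - a / b + a / b * Real.exp (b * s)) * b = b - a + a * Real.exp (b * s) := by
    field_simp
  linarith

theorem growthRate_pos {lamA lamB lamH γR : ℝ} (hA : 0 < lamA) (hB : 0 < lamB) (hH : 0 < lamH)
    (hR : 0 < γR) : 0 < growthRate lamA lamB lamH γR := by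
  unfold growthRate
  positivity

theorem dualAlpha₀_pos {lamA lamB lamH γR σ : ℝ} (hμ : 0 < growthRate lamA lamB lamH γR)
    (hσ : 0 < σ) : 0 < dualAlpha₀ lamA lamB lamH γR σ := by
  have : Real.exp (-2 * growthRate lamA lamB lamH γR * σ) < 1 := by
    rw [Real.exp_lt_one_iff]
    nlinarith [mul_pos hμ hσ]
  exact mul_pos (by positivity) (by linarith)

theorem dualAlpha₀_le {lamA lamB lamH γR σ : ℝ} (hμ : 0 < growthRate lamA lamB lamH γR) :
    dualAlpha₀ lamA lamB lamH γR σ ≤ σ := by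
  have := Real.add_one_le_exp (-2 * growthRate lamA lamB lamH γR * σ)
  unfold dualAlpha₀
  rw [one_div_mul_eq_div, div_le_iff₀ (by positivity)]
  linarith

theorem exp_growth_gt_one {μ σ : ℝ} (hμ : 0 < μ) (hσ : 0 < σ) : 1 < Real.exp (2 * μ * σ) :=
  Real.one_lt_exp_iff.2 (by positivity)

theorem dualAlpha₁_pos {lamA lamB lamH γR σ : ℝ} (hμ : 0 < growthRate lamA lamB lamH γR)
    (hσ : 0 < σ) : 0 < dualAlpha₁ lamA lamB lamH γR σ :=
  mul_pos (by positivity) (sub_pos.2 (exp_growth_gt_one hμ hσ))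

theorem riccatiLower_pos {lamA lamB lamH γR γQ σ : ℝ} (hA : 0 < lamA) (hB : 0 < lamB)
    (hH : 0 < lamH) (hR : 0 < γR) (hQ : 0 < γQ) (hσ : 0 < σ) :
    0 < riccatiLower lamA lamB lamH γR γQ σ := by
  have hμ := growthRate_pos hA hB hH hR
  have h0 := dualAlpha₀_pos hμ hσ
  have h1 := dualAlpha₁_pos hμ hσ
  unfold riccatiLower
  refine mul_pos (lt_min ?_ ?_) (Real.exp_pos _) <;> positivity

/-- The linear dual profile never exceeds `1` and has slope `1 / σ`, so its cost lacks the factor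
`(1 + α̃₁ / α̃₀) ^ 2` and has `1 / σ ^ 2` for `1 / α̃₀ ^ 2`; here `α̃₀ ≤ σ`. -/
theorem riccatiLower_le_interior {lamA lamB lamH γR γQ σ : ℝ} (hA : 0 < lamA) (hB : 0 < lamB)
    (hH : 0 < lamH) (hR : 0 < γR) (hQ : 0 < γQ) (hσ : 0 < σ) :
    riccatiLower lamA lamB lamH γR γQ σ ≤
      ((lamB ^ 2 / γR + (1 / σ) ^ 2 / γQ) *
        ((Real.exp (2 * growthRate lamA lamB lamH γR * σ) - 1) /
          (2 * growthRate lamA lamB lamH γR)))⁻¹ := by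
  have hμ := growthRate_pos hA hB hH hR
  have h0 := dualAlpha₀_pos hμ hσ
  have h1 := dualAlpha₁_pos hμ hσ
  have h2 := dualAlpha₀_le (σ := σ) hμ
  unfold riccatiLower
  refine (mul_le_mul_of_nonneg_right (min_le_left _ _) (Real.exp_pos _).le).trans ?_
  set a₀ := dualAlpha₀ lamA lamB lamH γR σ
  set a₁ := dualAlpha₁ lamA lamB lamH γR σ
  set μ := growthRate lamA lamB lamH γR
  have hE : 0 < Real.exp (2 * μ * σ) - 1 := sub_pos.2 (exp_growth_gt_one hμ hσ)
  have e : 2 * μ * (lamB ^ 2 / γR * (1 + a₁ / a₀) ^ 2 + 1 / (γQ * a₀ ^ 2))⁻¹ *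
      Real.exp (-2 * μ * σ) = ((lamB ^ 2 / γR * (1 + a₁ / a₀) ^ 2 + 1 / (γQ * a₀ ^ 2)) *
        (Real.exp (2 * μ * σ) / (2 * μ)))⁻¹ := by
    rw [neg_mul, neg_mul, Real.exp_neg, mul_inv, inv_div]
    ring
  rw [e]
  refine inv_anti₀ (by positivity) ?_
  have h3 : lamB ^ 2 / γR ≤ lamB ^ 2 / γR * (1 + a₁ / a₀) ^ 2 :=
    le_mul_of_one_le_right (by positivity) (one_le_pow₀ (by linarith [div_pos h1 h0]))
  have h4 : (1 / σ) ^ 2 / γQ ≤ 1 / (γQ * a₀ ^ 2) := by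
    rw [div_pow, one_pow, div_div, mul_comm]
    gcongr
  gcongr
  linarith

theorem riccatiLower_le_terminal {lamA lamB lamH γR γQ σ s : ℝ} (hA : 0 < lamA) (hB : 0 < lamB)
    (hH : 0 < lamH) (hR : 0 < γR) (hQ : 0 < γQ) (hs : 0 ≤ s) (hsσ : s ≤ σ) :
    riccatiLower lamA lamB lamH γR γQ σ ≤
      (lamB ^ 2 / γR * ((Real.exp (2 * growthRate lamA lamB lamH γR * s) - 1) /
          (2 * growthRate lamA lamB lamH γR)) +
        1 / γQ * Real.exp (2 * growthRate lamA lamB lamH γR * s))⁻¹ := by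
  have hμ := growthRate_pos hA hB hH hR
  unfold riccatiLower
  refine (mul_le_mul_of_nonneg_right (min_le_right _ _) (Real.exp_pos _).le).trans ?_
  set μ := growthRate lamA lamB lamH γR
  have hE : 0 ≤ Real.exp (2 * μ * s) - 1 := sub_nonneg.2 (Real.one_le_exp (by positivity))
  have hm : Real.exp (2 * μ * s) ≤ Real.exp (2 * μ * σ) := by gcongr
  rw [neg_mul, neg_mul, Real.exp_neg, ← mul_inv]
  have hp : 0 < 1 / γQ * Real.exp (2 * μ * s) := by positivity
  refine inv_anti₀ (by positivity) ?_
  have e : (lamB ^ 2 / (2 * γR * μ) + 1 / γQ) * Real.exp (2 * μ * σ) =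
    lamB ^ 2 / γR * (Real.exp (2 * μ * σ) / (2 * μ)) + 1 / γQ * Real.exp (2 * μ * σ) := by
      field_simp
  rw [e]
  gcongr
  linarith

theorem shiftedAlpha₀_pos {lamA lamH γR α₀ α₁ σ : ℝ} (hA : 0 < lamA) (hσ : 0 < σ) (h₀ : 0 < α₀) :
    0 < shiftedAlpha₀ lamA lamH γR α₀ α₁ σ := by
  have h := (sub_pos.2 (exp_growth_gt_one hA hσ)).le
  unfold shiftedAlpha₀
  have : 0 < 2 / α₀ := by positivity
  positivity

theorem shiftedAlpha₁_pos {lamA lamB lamH γR σ : ℝ} (hB : 0 < lamB)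
    (hμ : 0 < growthRate lamA lamB lamH γR) (hσ : 0 < σ) :
    0 < shiftedAlpha₁ lamA lamB lamH γR σ := by
  have h := sub_pos.2 (exp_growth_gt_one hμ hσ)
  unfold shiftedAlpha₁
  rw [mul_right_comm 2 σ]
  positivity

theorem riccatiUpper_pos {lamA lamB lamQ lamH lamR γR α₀ α₁ σ : ℝ} (hA : 0 < lamA)
    (hB : 0 < lamB) (hQ : 0 < lamQ) (hH : 0 < lamH) (hγ : 0 < γR) :
    0 < riccatiUpper lamA lamB lamQ lamH lamR γR α₀ α₁ σ := by
  have hμ := growthRate_pos hA hB hH hγ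
  unfold riccatiUpper
  refine mul_pos (lt_max_of_lt_right ?_) (Real.exp_pos _)
  positivity

theorem terminal_le_riccatiUpper {lamA lamB lamQ lamH lamR γR α₀ α₁ σ s : ℝ} (hA : 0 < lamA)
    (hB : 0 < lamB) (hQ : 0 < lamQ) (hH : 0 < lamH) (hγ : 0 < γR) (hs : s ≤ σ) :
    lamQ * (1 + 1 / (2 * growthRate lamA lamB lamH γR)) *
      Real.exp (2 * growthRate lamA lamB lamH γR * s) ≤
      riccatiUpper lamA lamB lamQ lamH lamR γR α₀ α₁ σ := by
  have hμ := growthRate_pos hA hB hH hγ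
  unfold riccatiUpper
  refine le_trans ?_ (mul_le_mul_of_nonneg_right (le_max_right _ _) (Real.exp_pos _).le)
  have : 0 ≤ lamH ^ 2 / γR := by positivity
  gcongr
  linarith

/-- The left side is the cost of steering `(A, B)`; the right side carries the Gramian constants
`α₀'`, `α₁'` attached to the shifted dynamics. The state and control costs are dominated separately.
-/
theorem interior_le_riccatiUpper {lamA lamB lamQ lamH lamR γR α₀ α₁ σ s : ℝ} (hA : 0 < lamA)
    (hB : 0 < lamB) (hQ : 0 < lamQ) (hH : 0 < lamH) (hR : 0 < lamR) (hγ : 0 < γR) (h₀ : 0 < α₀)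
    (hσ : 0 < σ) (hs : s ≤ σ)
    (hle : α₀ ≤ lamB ^ 2 * ((Real.exp (2 * lamA * σ) - 1) / (2 * lamA))) :
    lamQ * (1 + lamB ^ 2 * ((Real.exp (2 * lamA * σ) - 1) / (2 * lamA)) / α₀) ^ 2 *
        ((Real.exp (2 * lamA * s) - 1) / (2 * lamA)) +
      lamR * (2 / α₀ + 2 * (lamH / γR) ^ 2 * (1 + α₁ / α₀) ^ 2 *
        ((Real.exp (2 * lamA * s) - 1) / (2 * lamA))) ≤
      riccatiUpper lamA lamB lamQ lamH lamR γR α₀ α₁ σ := by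
  have hμ := growthRate_pos hA hB hH hγ
  have hp₀ := shiftedAlpha₀_pos (lamH := lamH) (γR := γR) (α₁ := α₁) hA hσ h₀
  have hp₁ := shiftedAlpha₁_pos hB hμ hσ
  unfold riccatiUpper
  refine le_trans ?_ (mul_le_mul_of_nonneg_right (le_max_left _ _) (Real.exp_pos _).le)
  have hmono : (Real.exp (2 * lamA * s) - 1) / (2 * lamA) ≤
      (Real.exp (2 * lamA * σ) - 1) / (2 * lamA) := by gcongr
  have hμA : (Real.exp (2 * lamA * σ) - 1) / (2 * lamA) ≤
      (Real.exp (2 * growthRate lamA lamB lamH γR * σ) - 1) /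
        (2 * growthRate lamA lamB lamH γR) := by
    refine exp_sub_one_div_mono (by positivity) ?_
    have : 0 ≤ lamB * lamH / γR := by positivity
    unfold growthRate
    linarith
  have hE0 : 0 < (Real.exp (2 * lamA * σ) - 1) / (2 * lamA) :=
    div_pos (sub_pos.2 (exp_growth_gt_one hA hσ)) (by positivity)
  -- The inverse of `α₀'` is exactly the bound on the energy of the compensated control over a time
  -- `σ`.
  have e₀ : (shiftedAlpha₀ lamA lamH γR α₀ α₁ σ)⁻¹ = 2 / α₀ + 2 * (lamH / γR) ^ 2 *
      (1 + α₁ / α₀) ^ 2 * ((Real.exp (2 * lamA * σ) - 1) / (2 * lamA)) := by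
    unfold shiftedAlpha₀
    rw [inv_inv]
    field_simp
  have e₁ : shiftedAlpha₁ lamA lamB lamH γR σ = lamB ^ 2 *
      ((Real.exp (2 * growthRate lamA lamB lamH γR * σ) - 1) /
        (2 * growthRate lamA lamB lamH γR)) := by
    unfold shiftedAlpha₁
    rw [mul_right_comm 2 σ, mul_div_assoc]
  have hinv : 1 / α₀ ≤ (shiftedAlpha₀ lamA lamH γR α₀ α₁ σ)⁻¹ := by
    rw [e₀]
    have h1 : 0 ≤ 2 * (lamH / γR) ^ 2 *
      (1 + α₁ / α₀) ^ 2 * ((Real.exp (2 * lamA * σ) - 1) / (2 * lamA)) := by positivity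
    have h2 : 0 < 1 / α₀ := by positivity
    have h3 : 2 / α₀ = 1 / α₀ + 1 / α₀ := by ring
    linarith
  set a₀ := shiftedAlpha₀ lamA lamH γR α₀ α₁ σ
  set a₁ := shiftedAlpha₁ lamA lamB lamH γR σ
  set μ := growthRate lamA lamB lamH γR
  set E := (Real.exp (2 * lamA * σ) - 1) / (2 * lamA)
  set Eμ := (Real.exp (2 * μ * σ) - 1) / (2 * μ)
  have hEμ : Eμ ≤ Real.exp (2 * μ * σ) * (1 / (2 * μ)) := by
    rw [mul_one_div]
    simp only [Eμ]
    gcongr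
    linarith
  have ha : a₀ ≤ α₀ := by
    rw [one_div] at hinv
    exact (inv_le_inv₀ h₀ hp₀).1 hinv
  have hr : lamB ^ 2 * E / α₀ ≤ a₁ / a₀ := by
    rw [e₁] at hp₁ ⊢
    gcongr
  have hlamH : 0 ≤ lamH ^ 2 / γR := by positivity
  have t1 : lamQ * (1 + lamB ^ 2 * E / α₀) ^ 2 * ((Real.exp (2 * lamA * s) - 1) / (2 * lamA)) ≤
      (lamQ + lamH ^ 2 / γR) * (1 + a₁ / a₀) ^ 2 * (Real.exp (2 * μ * σ) * (1 / (2 * μ))) := by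
    calc _ ≤ lamQ * (1 + lamB ^ 2 * E / α₀) ^ 2 * E := by gcongr
      _ ≤ (lamQ + lamH ^ 2 / γR) * (1 + a₁ / a₀) ^ 2 * (Real.exp (2 * μ * σ) * (1 / (2 * μ))) := by
        gcongr
        · linarith
        · exact hμA.trans hEμ
  have t2 : lamR * (2 / α₀ + 2 * (lamH / γR) ^ 2 * (1 + α₁ / α₀) ^ 2 *
        ((Real.exp (2 * lamA * s) - 1) / (2 * lamA))) ≤
      lamR * lamB ^ 2 / a₀ ^ 2 * (Real.exp (2 * μ * σ) * (1 / (2 * μ))) := by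
    calc _ ≤ lamR * a₀⁻¹ := by
          rw [e₀]
          gcongr
      _ ≤ lamR * (a₁ / a₀ ^ 2) := by
          gcongr
          rw [inv_eq_one_div, div_le_div_iff₀ hp₀ (by positivity), one_mul, sq]
          -- This turns `1 / a₀` into `a₁ / a₀ ^ 2`, through the chain `a₀ ≤ α₀ ≤ lamB ^ 2 * E ≤
          -- a₁`.
          have : a₀ ≤ a₁ := by
            rw [e₁]
            exact (ha.trans hle).trans (by gcongr)
          gcongr
      _ = lamR * lamB ^ 2 / a₀ ^ 2 * Eμ := by rw [e₁]; ring
      _ ≤ _ := by gcongr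
  have e : ((lamQ + lamH ^ 2 / γR) * (1 + a₁ / a₀) ^ 2 + lamR * lamB ^ 2 / a₀ ^ 2) *
      (1 / (2 * μ)) * Real.exp (2 * μ * σ) =
    (lamQ + lamH ^ 2 / γR) * (1 + a₁ / a₀) ^ 2 * (Real.exp (2 * μ * σ) * (1 / (2 * μ))) +
      lamR * lamB ^ 2 / a₀ ^ 2 * (Real.exp (2 * μ * σ) * (1 / (2 * μ))) := by ring
  rw [e]
  exact add_le_add t1 t2

end Constants

/-! ### Assembly of the theorem. -/

theorem mainTheorem5 (n m : ℕ) (T σ : ℝ)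
    (lamA lamB lamQ lamH lamR γR γQ α₀ α₁ β₀ β₁ : ℝ)
    (A : ℝ → Matrix (Fin n) (Fin n) ℝ) (B : ℝ → Matrix (Fin n) (Fin m) ℝ)
    (Q : ℝ → Matrix (Fin n) (Fin n) ℝ) (H : ℝ → Matrix (Fin m) (Fin n) ℝ)
    (R : ℝ → Matrix (Fin m) (Fin m) ℝ) (QT : Matrix (Fin n) (Fin n) ℝ)
    (hbdd : BoundedData T lamA lamB lamQ lamH lamR A B Q H R)
    (hucc : UniformlyCompletelyControllable T σ α₀ α₁ β₀ β₁ A B)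
    (hcoer : CoerciveCost T γR γQ lamQ Q H R QT) :
    0 < riccatiLower lamA lamB lamH γR γQ σ ∧
    0 < riccatiUpper lamA lamB lamQ lamH lamR γR α₀ α₁ σ ∧
    ∃ S : ℝ → Matrix (Fin n) (Fin n) ℝ,
      IsRiccatiSolution T A B Q H R QT S ∧
      (∀ S' : ℝ → Matrix (Fin n) (Fin n) ℝ,
        IsRiccatiSolution T A B Q H R QT S' → EqOn S' S (Icc 0 T)) ∧
      ∀ t ∈ Icc 0 T,
        riccatiLower lamA lamB lamH γR γQ σ • (1 : Matrix (Fin n) (Fin n) ℝ) ≤ S t ∧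
        S t ≤ riccatiUpper lamA lamB lamQ lamH lamR γR α₀ α₁ σ •
          (1 : Matrix (Fin n) (Fin n) ℝ) := by
  obtain ⟨hA0, hB0, hQ0, hH0, hR0, hAc, hBc, hQc, hHc, hRc, hA, hB, hQ, hH, hR⟩ := hbdd
  obtain ⟨⟨hσ0, hσT⟩, hα₀, hα₁, -, -, hW⟩ := hucc
  obtain ⟨hγR, hγQ, -, hRl, hPl, hQTl, hQTu⟩ := hcoer
  simp only [smul_one_le_iff] at hRl hPl hQTl
  rw [le_smul_one_iff] at hQTu
  have hT : 0 ≤ T := (hσ0.trans hσT).le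
  have hμ := growthRate_pos hA0 hB0 hH0 hγR
  refine ⟨riccatiLower_pos hA0 hB0 hH0 hγR hγQ hσ0,
    riccatiUpper_pos hA0 hB0 hQ0 hH0 hγR, ?_⟩
  let F : ℝ → Matrix (Fin n) (Fin n) ℝ := fun t => A t - B t * (R t)⁻¹ * H t
  let G : ℝ → Matrix (Fin n) (Fin n) ℝ := fun t => B t * (R t)⁻¹ * (B t)ᵀ
  let P : ℝ → Matrix (Fin n) (Fin n) ℝ := fun t => Q t - (H t)ᵀ * (R t)⁻¹ * H t
  have hRi : ContinuousOn (fun t => (R t)⁻¹) (Icc 0 T) :=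
    hRc.matrix_inv fun t ht => isUnit_of_coercive hγR (hRl t ht).2
  have hFc : ContinuousOn F (Icc 0 T) := by fun_prop
  have hGc : ContinuousOn G (Icc 0 T) := by fun_prop
  have hPc : ContinuousOn P (Icc 0 T) := by fun_prop
  have hGs : ∀ t ∈ Icc 0 T, (G t)ᵀ = G t := fun t ht => inputWeight_transpose (hRl t ht).1
  have hG0 : ∀ t ∈ Icc 0 T, ∀ x, 0 ≤ x ⬝ᵥ G t *ᵥ x := fun t ht =>
    inputWeight_form_nonneg hγR (hRl t ht).2
  have hP0 : ∀ t ∈ Icc 0 T, ∀ x, 0 ≤ x ⬝ᵥ P t *ᵥ x := fun t ht x =>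
    (mul_nonneg hγQ.le (dotProduct_self_nonneg' x)).trans ((hPl t ht).2 x)
  have hFμ : ∀ t ∈ Icc 0 T, ∀ x, |x ⬝ᵥ F t *ᵥ x| ≤ growthRate lamA lamB lamH γR * (x ⬝ᵥ x) :=
    fun t ht => closedLoop_form_le hγR (hA t ht) (hB t ht) (hH t ht) (hRl t ht).2
  have hPu : ∀ t ∈ Icc 0 T, ∀ x, x ⬝ᵥ P t *ᵥ x ≤ lamQ * (x ⬝ᵥ x) := fun t ht =>
    stateCost_form_le hγR (hQ t ht) (hRl t ht).2
  obtain ⟨S, hST, hSs, hS⟩ := exists_symmetric_riccati_solution hT hγQ hFc hGc hPc hGs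
    (fun t ht => (hPl t ht).1) hG0 hP0 hQTl.1 hQTl.2
  have hSc : ContinuousOn S (Icc 0 T) := fun t ht => (hS t ht).continuousWithinAt
  have hS0 : ∀ t ∈ Icc 0 T, ∀ x, 0 ≤ x ⬝ᵥ S t *ᵥ x := fun t ht =>
    riccati_solution_nonneg hFc hGc hSs hS hG0 hP0
      (fun x => by
        rw [hST]
        exact (mul_nonneg hγQ.le (dotProduct_self_nonneg' x)).trans (hQTl.2 x)) ht
  have hquad : ∀ (M : Matrix (Fin n) (Fin n) ℝ) t, M * B t * (R t)⁻¹ * (B t)ᵀ * M = M * G t * M :=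
    fun M t => by simp only [G, Matrix.mul_assoc]
  refine ⟨S, ⟨hSc, fun t ht => ?_, hST⟩, fun S' hS' => ?_, fun t ht => ⟨?_, ?_⟩⟩
  · rw [hquad]
    exact hS t (Ico_subset_Icc_self ht)
  · refine riccati_solution_unique hFc hGc hGs hSc hS'.continuousOn hSs
      (fun t ht => hS t (Ico_subset_Icc_self ht)) (fun t ht => ?_) (hS'.terminal.trans hST.symm)
    rw [← hquad]
    exact hS'.hasDeriv t ht
  · refine smul_one_le_iff.2 ⟨hSs t ht, fun x => ?_⟩
    have hx := dotProduct_self_nonneg' x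
    have dual := fun k b => riccati_dual_estimate (k := k) (b := b) (t := t)
      hFc hGc hGs hSs hS hμ hFμ hG0
      (by positivity) (fun t ht => inputWeight_form_le hγR (hB t ht) (hRl t ht).2) hγQ
      (fun t ht => (hPl t ht).2) ht.1
    rcases le_total (t + σ) T with h | h
    · refine (mul_le_mul_of_nonneg_right
        (riccatiLower_le_interior hA0 hB0 hH0 hγR hγQ hσ0) hx).trans ?_
      refine le_form_of_conjugate_le (mul_pos (by positivity)
        (div_pos (sub_pos.2 (exp_growth_gt_one hμ hσ0)) (by positivity))) fun ξ => ?_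
      have e : 1 / σ * (t + σ - t) = 1 := by field_simp; ring
      -- Slope `1 / σ` makes the dual state vanish at `t + σ`, leaving only `-y · S y ≤ 0` there.
      obtain ⟨z, y, hz, hzy⟩ := dual (1 / σ) (t + σ) (by linarith) h (by positivity) e.le ξ x
      rw [e, sub_self, zero_pow two_ne_zero, zero_mul] at hz
      have hz0 : z = 0 := dotProduct_self_eq_zero.1 (le_antisymm hz (dotProduct_self_nonneg' z))
      have h1 := hS0 (t + σ) ⟨by linarith [ht.1], h⟩ y
      rw [hz0, zero_dotProduct, add_sub_cancel_left] at hzy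
      linarith
    · have hs : 0 ≤ T - t := sub_nonneg.2 ht.2
      refine (mul_le_mul_of_nonneg_right (riccatiLower_le_terminal (s := T - t)
        hA0 hB0 hH0 hγR hγQ hs (by linarith)) hx).trans ?_
      have hE : 0 ≤ Real.exp (2 * growthRate lamA lamB lamH γR * (T - t)) - 1 :=
        sub_nonneg.2 (Real.one_le_exp (by positivity))
      refine le_form_of_conjugate_le (add_pos_of_nonneg_of_pos (by positivity) (by positivity))
        fun ξ => ?_
      -- Less than a window remains: the dual state runs freely to `T`, and `2 z · y - y · QT y ≤
      -- |z|² / γQ`.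
      obtain ⟨z, y, hz, hzy⟩ := dual 0 T ht.2 le_rfl le_rfl (by simp) ξ x
      have h1 := hQTl.2 y
      have h2 := two_mul_dotProduct_le hγQ y z
      have h3 := mul_le_mul_of_nonneg_left hz (by positivity : 0 ≤ 1 / γQ)
      rw [hST] at hzy
      simp only [zero_mul, sub_zero, one_pow, one_mul, ne_eq, OfNat.ofNat_ne_zero,
        not_false_eq_true, zero_pow, zero_div, add_zero] at hzy h3
      rw [dotProduct_comm z y] at hzy
      linarith
  · refine le_smul_one_iff.2 ⟨hSs t ht, fun x => ?_⟩
    have hx := dotProduct_self_nonneg' x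
    rcases le_total t (T - σ) with h | h
    · rcases hx.eq_or_lt with h0 | h0
      · rw [dotProduct_self_eq_zero.1 h0.symm]
        simp
      obtain ⟨b, ⟨htb, hbσ⟩, hWl, hWu, -, -⟩ := hW t ⟨ht.1, h⟩
      rw [smul_one_le_iff] at hWl
      rw [le_smul_one_iff] at hWu
      have hbT : b ≤ T := by linarith
      have hAl : ∀ t ∈ Icc 0 T, ∀ x, |x ⬝ᵥ A t *ᵥ x| ≤ lamA * (x ⬝ᵥ x) := fun t ht =>
        abs_dotProduct_mulVec_self_le hA0.le (mulVec_sq_le (hA t ht))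
      -- A second upper bound on the Gramian, from the data alone: `α₁` may be arbitrarily large
      -- compared with `α₁'`, whereas this bound is at most `α₁'`.
      have hWa : ∀ x, x ⬝ᵥ gramian A B t b *ᵥ x ≤
          lamB ^ 2 * ((Real.exp (2 * lamA * σ) - 1) / (2 * lamA)) * (x ⬝ᵥ x) := fun x => by
        refine (gramian_form_le hAc hBc hA0 hAl hB ht.1 htb hbT x).trans ?_
        have := dotProduct_self_nonneg' x
        gcongr
        linarith
      have hα : α₀ ≤ lamB ^ 2 * ((Real.exp (2 * lamA * σ) - 1) / (2 * lamA)) :=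
        le_of_mul_le_mul_right ((hWl.2 x).trans (hWa x)) h0
      refine (riccati_le_of_minimum_energy hAc hBc (K := fun t => (R t)⁻¹ * H t)
        (fun t _ => by simp only [F, Matrix.mul_assoc]) hSs hS hA0 hAl
        (fun t ht => neg_inputCost_le hγR (hRl t ht).1 (hRl t ht).2) hQ0.le hPu hR0.le
        (fun t ht v => (le_abs_self _).trans
          (abs_dotProduct_mulVec_self_le hR0.le (mulVec_sq_le (hR t ht)) v))
        (fun t ht => feedback_mulVec_sq_le hγR (hH t ht) (hRl t ht).2) hα₀
        (hα₀.trans_le hα) hα₁ hWl.2 hWa hWu.2 ht.1 htb hbT x).trans ?_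
      exact mul_le_mul_of_nonneg_right (interior_le_riccatiUpper hA0 hB0 hQ0 hH0 hR0 hγR hα₀ hσ0
        (by linarith) hα) hx
    · refine (riccati_le_of_free_motion hFc hSs hS hμ hFμ hG0 hQ0.le hPu
        (fun x => by rw [hST]; exact hQTu.2 x) ht x).trans ?_
      exact mul_le_mul_of_nonneg_right
        (terminal_le_riccatiUpper hA0 hB0 hQ0 hH0 hγR (by linarith)) hx
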